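/- Let $B=(B(t))_{t\in\mathbb R}$ be a fractional Brownian motion with Hurst parameter $H\in(0,1)$ and scaling coefficient $C>0$, i.e. a centered Gaussian process with stationary increments and $\operatorname{Var} B(t)=C^2|t|^{2H}$. Let $a=(a_0,\dots,a_\ell)$ be a real filter of order $p\ge 2$, i.e. $\sum_{q=0}^{\ell} q^j a_q=0$ for $0\le j\le p-1$ and $\sum_{q=0}^\ell q^p a_q\neq 0$, such that $\sum_{q,r=0}^\ell a_qa_r(q-r)^2\log|q-r|\neq 0$ (with $0\log 0=0$). For $m\ge 1$ let $a^m$ be the dilated filter of length $m\ell+1$, with $a^m_i=a_{i/m}$ if $m\mid i$ and $a^m_i=0$ otherwise. For a filter $b=(b_0,\dots,b_L)$ put $$S_n^{b}=\frac1{n-L}\sum_{i=L}^{n-1}\Big(\sum_{q=0}^{L} b_q B\big(\tfrac{i-q}{n}\big)\Big)^2,\quad \pi_h^{b}(j)=-\tfrac12\sum_{q,r=0}^{L}b_qb_r|q-r+j|^{2h},\quad \kappa^{b}=2\sup_{h\in(0,1)}\sum_{j\in\mathbb Z}\Big|\frac{\pi_h^{b}(j)}{\pi_h^{b}(0)}\Big|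 .$$ For $\beta\in(0,1)$ and an integer $k\ge1$ let $q_{r,k}^{b}(\beta)\in(0,\infty)$ be the solution $t$ of $e^{-t\sqrt k/\kappa^{b}}(1+t/\sqrt k)^{k/\kappa^{b}}=\beta$ and $q_{l,k}^{b}(\beta)\in(0,\sqrt k)$ the solution $t$ of $e^{t\sqrt k/\kappa^{b}}(1-t/\sqrt k)^{k/\kappa^{b}}=\beta$, and put $$x_{r,k}^{b}(\beta)=1+\frac{q_{r,k}^{b}(\beta)}{\sqrt k},\qquad x_{l,k}^{b}(\beta)=1-\frac{q_{l,k}^{b}(\beta)}{\sqrt k},\qquad q^{b}(\beta)=\sqrt{2\kappa^{b}\log(1/\beta)} .$$ Let $M\ge2$ and let $d=(d_1,\dots,d_M)$ have non-zero real components with $\sum_{m=1}^M d_m=0$ and $d^{T}L_M>0$, where $L_M=(\log m)_{1\le m\le M}$. Let $\alpha\in(0,1)$, and set $L_{S_n}=(\log S_n^{a^m})_{1\le m\le M}$, $$(L_{X_n^{\inf}})_m=\begin{cases}\log x^{a^m}_{l,n-m\ell}(\tfrac{\alpha}{2M})& d_m<0\\ \log x^{a^m}_{r,n-m\ell}(\tfrac{\alpha}{2M})&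 d_m>0\end{cases},\qquad (L_{X_n^{\sup}})_m=\begin{cases}\log x^{a^m}_{r,n-m\ell}(\tfrac{\alpha}{2M})& d_m<0\\ \log x^{a^m}_{l,n-m\ell}(\tfrac{\alpha}{2M})& d_m>0\end{cases},$$ $$\widetilde H_n^{\inf}=\max\Big(0,\frac{d^{T}L_{S_n}-d^{T}L_{X_n^{\inf}}}{2\,d^{T}L_M}\Big),\qquad \widetilde H_n^{\sup}=\min\Big(1,\frac{d^{T}L_{S_n}-d^{T}L_{X_n^{\sup}}}{2\,d^{T}L_M}\Big)$$ (quantities that do not involve $C$ or $H$). Then: 1. For every $n\ge M\ell+1$, $\;\mathbb P\big(H\in[\widetilde H_n^{\inf},\widetilde H_n^{\sup}]\big)\ge 1-\alpha$. 2. Almost surely, as $n\to\infty$, the interval $[\widetilde H_n^{\inf},\widetilde H_n^{\sup}]$ converges to $\{H\}$ (it is non-empty for all large $n$ and both end points tend to $H$), and for all large $n$ its length $\widetilde H_n^{\sup}-\widetilde H_n^{\inf}$ equals $$\mu_n:=\frac{d^{T}(L_{X_n^{\inf}}-L_{X_n^{\sup}})}{2\,d^{T}L_M}\;\sim\;\frac1{\sqrt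 n}\,\frac{d^{T}q_M}{d^{T}L_M}\quad(n\to\infty),$$ where $(q_M)_m=-q^{a^m}(\tfrac{\alpha}{2M})$ if $d_m<0$ and $(q_M)_m=q^{a^m}(\tfrac{\alpha}{2M})$ if $d_m>0$. -/

import Mathlib

open MeasureTheory ProbabilityTheory Filter Topology Asymptotics

noncomputable section

namespace HurstCI

/-- Fractional Brownian motion with Hurst parameter `H` and scaling coefficient `C`: a centered
Gaussian process indexed by `ℝ`, with stationary increments (in the sense of finite-dimensional
distributions) and with variance function `t ↦ C ^ 2 * |t| ^ (2 * H)`. -/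
structure IsFractionalBrownianMotion {Ω : Type*} [MeasurableSpace Ω] (P : Measure Ω)
    (H C : ℝ) (B : ℝ → Ω → ℝ) : Prop where
  gaussian : IsGaussianProcess B P
  centered : ∀ t : ℝ, ∫ ω, B t ω ∂P = 0
  stationary_increments : ∀ (h : ℝ) (I : Finset ℝ),
    IdentDistrib (fun ω => fun t : I => B ((t : ℝ) + h) ω - B h ω)
      (fun ω => fun t : I => B (t : ℝ) ω - B 0 ω) P P
  variance_eq : ∀ t : ℝ, variance (B t) P = C ^ 2 * |t| ^ (2 * H)

/-- The vector `(a_0, …, a_ℓ)` is a filter of length `ℓ + 1` and of order `p`. -/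
def IsFilterOfOrder {ℓ : ℕ} (a : Fin (ℓ + 1) → ℝ) (p : ℕ) : Prop :=
  (∀ j < p, ∑ q : Fin (ℓ + 1), ((q : ℕ) : ℝ) ^ j * a q = 0) ∧ ∑ q : Fin (ℓ + 1), ((q : ℕ) : ℝ) ^ p * a q ≠ 0

/-- `τ^a = ∑_{q,r} a_q a_r (q - r)² log |q - r|`, with `0 log 0 = 0`. -/
def tau {ℓ : ℕ} (a : Fin (ℓ + 1) → ℝ) : ℝ :=
  ∑ q, ∑ r, a q * a r * (((q : ℕ) : ℝ) - ((r : ℕ) : ℝ)) ^ 2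
    * Real.log |((q : ℕ) : ℝ) - ((r : ℕ) : ℝ)|

/-- The dilated filter `a^m`, of length `m ℓ + 1`: its `i`-th component is `a_{i/m}` if `m` divides
`i` and `0` otherwise. -/
def dilate {ℓ : ℕ} (m : ℕ) (a : Fin (ℓ + 1) → ℝ) : Fin (m * ℓ + 1) → ℝ := fun i =>
  if m ∣ (i : ℕ) then
    a ⟨(i : ℕ) / m, Nat.lt_succ_of_le (Nat.div_le_of_le_mul (Nat.le_of_lt_succ i.isLt))⟩
  else 0

/-- The normalized covariance `π_H^a(j) = -(1/2) ∑_{q,r} a_q a_r |q - r + j|^{2H}`. -/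
def covFun {ℓ : ℕ} (a : Fin (ℓ + 1) → ℝ) (H : ℝ) (j : ℤ) : ℝ :=
  -(1 / 2) * ∑ q, ∑ r, a q * a r * |((q : ℕ) : ℝ) - ((r : ℕ) : ℝ) + (j : ℝ)| ^ (2 * H)

/-- The correlation function `ρ_H^a(j) = π_H^a(j) / π_H^a(0)`. -/
def corrFun {ℓ : ℕ} (a : Fin (ℓ + 1) → ℝ) (H : ℝ) (j : ℤ) : ℝ :=
  covFun a H j / covFun a H 0

/-- `κ^a = 2 sup_{H ∈ (0,1)} ‖ρ_H^a‖_{ℓ¹(ℤ)}`. -/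
def kappa {ℓ : ℕ} (a : Fin (ℓ + 1) → ℝ) : ℝ :=
  2 * ⨆ H : Set.Ioo (0 : ℝ) 1, ∑' j : ℤ, |corrFun a (H : ℝ) j|

/-- The right tail bound `φ_{r,n}(t; κ) = e^{-t√n/κ} (1 + t/√n)^{n/κ}`. -/
def phiR (n : ℕ) (κ t : ℝ) : ℝ :=
  Real.exp (-(t * √(n : ℝ) / κ)) * (1 + t / √(n : ℝ)) ^ ((n : ℝ) / κ)

/-- The left tail bound `φ_{l,n}(t; κ) = e^{t√n/κ} (1 - t/√n)^{n/κ} 1_{[0,√n]}(t)`. -/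
def phiL (n : ℕ) (κ t : ℝ) : ℝ :=
  (Set.Icc (0 : ℝ) (√(n : ℝ))).indicator
    (fun t => Real.exp (t * √(n : ℝ) / κ) * (1 - t / √(n : ℝ)) ^ ((n : ℝ) / κ)) t

/-- `q_{r,n}^a(α)`: the value at `α` of the inverse of the bijection
`φ_{r,n}(·; κ^a) : (0,∞) → (0,1)`. -/
def quantR {ℓ : ℕ} (a : Fin (ℓ + 1) → ℝ) (n : ℕ) (α : ℝ) : ℝ :=
  Function.invFunOn (phiR n (kappa a)) (Set.Ioi 0) α

/-- `q_{l,n}^a(α)`: the value at `α` of the inverse of the bijection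
`φ_{l,n}(·; κ^a) : (0,√n) → (0,1)`. -/
def quantL {ℓ : ℕ} (a : Fin (ℓ + 1) → ℝ) (n : ℕ) (α : ℝ) : ℝ :=
  Function.invFunOn (phiL n (kappa a)) (Set.Ioo 0 (√(n : ℝ))) α

/-- `x_{r,n}^a(α) = 1 + q_{r,n}^a(α)/√n`. -/
def xR {ℓ : ℕ} (a : Fin (ℓ + 1) → ℝ) (n : ℕ) (α : ℝ) : ℝ := 1 + quantR a n α / √(n : ℝ)

/-- `x_{l,n}^a(α) = 1 - q_{l,n}^a(α)/√n`. -/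
def xL {ℓ : ℕ} (a : Fin (ℓ + 1) → ℝ) (n : ℕ) (α : ℝ) : ℝ := 1 - quantL a n α / √(n : ℝ)

/-- The limiting quantile `q^a(α) = √(2 κ^a log(1/α))`. -/
def quantLim {ℓ : ℕ} (a : Fin (ℓ + 1) → ℝ) (α : ℝ) : ℝ :=
  √(2 * kappa a * Real.log (1 / α))

/-- The filtered series `V^a(i/n) = ∑_q a_q b((i - q)/n)` of the path `b`. -/
def filtered {ℓ : ℕ} (a : Fin (ℓ + 1) → ℝ) (n : ℕ) (b : ℝ → ℝ) (i : ℕ) : ℝ :=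
  ∑ q, a q * b (((i : ℝ) - ((q : ℕ) : ℝ)) / (n : ℝ))

/-- The quadratic variation `S_n^a = (n - ℓ)⁻¹ ∑_{i=ℓ}^{n-1} V^a(i/n)²`. It depends on the path `b`
only through the observations `b(i/n)`, `0 ≤ i ≤ n - 1`. -/
def quadVar {ℓ : ℕ} (a : Fin (ℓ + 1) → ℝ) (n : ℕ) (b : ℝ → ℝ) : ℝ :=
  1 / ((n : ℝ) - (ℓ : ℝ)) * ∑ i ∈ Finset.Ico ℓ n, filtered a n b i ^ 2

/-- `dᵀu = ∑_{m=1}^M d_m u_m`, the components of a vector of length `M` being numbered from `1` to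
`M` (other values are irrelevant). -/
def dotM (M : ℕ) (d u : ℕ → ℝ) : ℝ := ∑ m ∈ Finset.Icc 1 M, d m * u m

/-- The vector `L_M = (log m)_m`. -/
def logVec (m : ℕ) : ℝ := Real.log (m : ℝ)

/-- The vector `L_{S_n} = (log S_n^{a^m})_m`. -/
def logS {ℓ : ℕ} (a : Fin (ℓ + 1) → ℝ) (n : ℕ) (b : ℝ → ℝ) (m : ℕ) : ℝ :=
  Real.log (quadVar (dilate m a) n b)

/-- The vector `L_{X_n^inf}`; the second branch is `m ∈ I⁺`, since the `d_m` are non-zero. -/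
def logXinf {ℓ : ℕ} (a : Fin (ℓ + 1) → ℝ) (M : ℕ) (d : ℕ → ℝ) (α : ℝ) (n m : ℕ) : ℝ :=
  if d m < 0 then Real.log (xL (dilate m a) (n - m * ℓ) (α / (2 * M)))
  else Real.log (xR (dilate m a) (n - m * ℓ) (α / (2 * M)))

/-- The vector `L_{X_n^sup}`; the second branch is `m ∈ I⁺`, since the `d_m` are non-zero. -/
def logXsup {ℓ : ℕ} (a : Fin (ℓ + 1) → ℝ) (M : ℕ) (d : ℕ → ℝ) (α : ℝ) (n m : ℕ) : ℝ :=
  if d m < 0 then Real.log (xR (dilate m a) (n - m * ℓ) (α / (2 * M)))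
  else Real.log (xL (dilate m a) (n - m * ℓ) (α / (2 * M)))

/-- The vector `q_M(α/2M)`; the second branch is `m ∈ I⁺`, since the `d_m` are non-zero. -/
def quantVec {ℓ : ℕ} (a : Fin (ℓ + 1) → ℝ) (M : ℕ) (d : ℕ → ℝ) (α : ℝ) (m : ℕ) : ℝ :=
  if d m < 0 then -quantLim (dilate m a) (α / (2 * M)) else quantLim (dilate m a) (α / (2 * M))

/-- The lower end of the confidence interval computed from the path `b`. -/
def Hinf {ℓ : ℕ} (a : Fin (ℓ + 1) → ℝ) (M : ℕ) (d : ℕ → ℝ) (α : ℝ) (n : ℕ) (b : ℝ → ℝ) : ℝ :=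
  max 0 (1 / (2 * dotM M d logVec) * (dotM M d (logS a n b) - dotM M d (logXinf a M d α n)))

/-- The upper end of the confidence interval computed from the path `b`. -/
def Hsup {ℓ : ℕ} (a : Fin (ℓ + 1) → ℝ) (M : ℕ) (d : ℕ → ℝ) (α : ℝ) (n : ℕ) (b : ℝ → ℝ) : ℝ :=
  min 1 (1 / (2 * dotM M d logVec) * (dotM M d (logS a n b) - dotM M d (logXsup a M d α n)))

/-- `μ_n = dᵀ(L_{X_n^inf} - L_{X_n^sup}) / (2 dᵀL_M)`. -/
def ciLength {ℓ : ℕ} (a : Fin (ℓ + 1) → ℝ) (M : ℕ) (d : ℕ → ℝ) (α : ℝ) (n : ℕ) : ℝ :=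
  dotM M d (fun m => logXinf a M d α n m - logXsup a M d α n m) / (2 * dotM M d logVec)

end HurstCI

end

/-!
The quadratic variation of the filtered fractional Brownian motion is a quadratic form in a centred
stationary Gaussian vector with correlations `ρ_H`. In an orthonormal basis of eigenvectors of the
covariance matrix it becomes a weighted sum of independent `χ²` variables. The weights are at most
`κ / 2` times the variance by Gershgorin's theorem, and the log-Laplace transform of a scaled `χ²`
variable is convex in the scale, so that Chernoff's method bounds both tails of `S_n / E S_n` at `x`
by `exp (-(N / κ) (x - 1 - log x))`, `N` being the number of terms (`chernoff_sum_sq`,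
`IsFractionalBrownianMotion.quadVar_concentration`). These bounds are exactly `φ_{r,N}` and
`φ_{l,N}`, and both quantiles `x_{r,N}`, `x_{l,N}` solve the same equation
`x - 1 - log x = (κ / N) log (1 / β)`, one on each side of `1` (`xR_spec`, `xL_spec`).

For this `κ` has to be finite, although the supremum that defines it runs over all of `(0, 1)`
(`kappa_pos_and_sum_le`). As `H → 1` both `π_H(j)` and `π_H(0)` vanish. Positivity of `π_H(0)` for
`H < 1`, which follows from the spectral representation of `|t|^{2H}`, together with `τ ≠ 0` and
compactness gives `π_H(0) ≥ m (1 - H)`; a fourth-order Taylor expansion gives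
`|π_H(j)| ≤ A (1 - H) / j²` for large `j`.

Since `E S_n^{a^m} = C² n^{-2H} m^{2H} π_H(0)` and `∑ d_m = 0`, the number `dᵀ L_{S_n}` is
`2 H dᵀ L_M` plus the combination of the `log (S_n / E S_n)`. A union bound over the `2 M` tails
gives the coverage. The Borel-Cantelli lemma gives `S_n / E S_n → 1` almost surely, hence the
convergence of the end points, and `x - 1 - log x ~ (log x)² / 2` gives the asymptotic length.
-/

noncomputable section

namespace HurstCI

/-! ### Chernoff bounds for Gaussian quadratic forms -/

lemma mgf_sq_gaussianReal {v : NNReal} {s : ℝ} (hs : 2 * s * v < 1) :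
    ∫ x, Real.exp (s * x ^ 2) ∂(gaussianReal 0 v) = (√(1 - 2 * s * v))⁻¹ := by
  by_cases hv : v = 0
  · subst hv
    simp [gaussianReal]
  have hv0 : (0 : ℝ) < v := by positivity
  rw [integral_gaussianReal_eq_integral_smul hv]
  have h : ∀ x : ℝ, gaussianPDFReal 0 v x • Real.exp (s * x ^ 2)
      = (√(2 * Real.pi * v))⁻¹ * Real.exp (-((1 - 2 * s * v) / (2 * v)) * x ^ 2) := by
    intro x
    rw [gaussianPDFReal_def, smul_eq_mul, mul_assoc, ← Real.exp_add]
    congr 2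
    field_simp
    ring
  simp_rw [h]
  rw [integral_const_mul, integral_gaussian]
  have h1 : 0 < 1 - 2 * s * v := by linarith
  rw [show Real.pi / ((1 - 2 * s * v) / (2 * v)) = (2 * Real.pi * v) / (1 - 2 * s * v) by
    field_simp, Real.sqrt_div (by positivity)]
  have : √(2 * Real.pi * v) ≠ 0 := by positivity
  field_simp

/-- The logarithm of the moment generating function of `Y²`, where `Y` is centred Gaussian of
variance `v`, is convex in `v`; hence it lies below its chord on `[0, K]`. -/
lemma inv_sqrt_le_exp {s v K : ℝ} (hv : 0 ≤ v) (hvK : v ≤ K) (hK : 0 < K) (hs : 2 * s * K < 1) :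
    (√(1 - 2 * s * v))⁻¹ ≤ Real.exp (-(v / (2 * K)) * Real.log (1 - 2 * s * K)) := by
  have hθ0 : 0 ≤ v / K := by positivity
  have hθ1 : v / K ≤ 1 := (div_le_one hK).2 hvK
  have hK1 : 0 < 1 - 2 * s * K := by linarith
  have key : (1 - v / K) * Real.log 1 + v / K * Real.log (1 - 2 * s * K)
      ≤ Real.log ((1 - v / K) * 1 + v / K * (1 - 2 * s * K)) :=
    strictConcaveOn_log_Ioi.concaveOn.2 (Set.mem_Ioi.2 one_pos) (Set.mem_Ioi.2 hK1)
      (by linarith) hθ0 (by ring)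
  simp only [Real.log_one, mul_zero, zero_add] at key
  have e : (1 - v / K) * 1 + v / K * (1 - 2 * s * K) = 1 - 2 * s * v := by
    field_simp
    ring
  rw [e] at key
  have hpos : 0 < 1 - 2 * s * v := by
    rw [← e]
    rcases hθ0.eq_or_lt with h | h
    · rw [← h]; norm_num
    · have := mul_pos h hK1
      linarith
  rw [← Real.exp_log (inv_pos.2 (Real.sqrt_pos.2 hpos)), Real.log_inv, Real.log_sqrt hpos.le]
  apply Real.exp_le_exp.2
  have : v / (2 * K) * Real.log (1 - 2 * s * K) = (v / K * Real.log (1 - 2 * s * K)) / 2 := by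
    field_simp
  linarith

section QuadraticForm

variable {Ω ι : Type*} [MeasurableSpace Ω] {P : Measure Ω} [Fintype ι]

/-- A centred Gaussian vector is, after an orthogonal change of coordinates, a vector of
independent centred Gaussian variables, whose variances are the eigenvalues of the covariance
matrix; by Gershgorin's theorem these are at most the largest absolute row sum of that matrix. -/
lemma exists_indep_sq_sum {X : ι → Ω → ℝ} (hX : HasGaussianLaw (fun ω i ↦ X i ω) P)
    (hc : ∀ i, ∫ ω, X i ω ∂P = 0) {K : ℝ} (hK : ∀ i, ∑ j, |cov[X i, X j; P]| ≤ K) :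
    ∃ (Y : ι → Ω → ℝ) (v : ι → NNReal), iIndepFun Y P ∧
      (∀ k, P.map (Y k) = gaussianReal 0 (v k)) ∧ (∀ k, AEMeasurable (Y k) P) ∧
      (∀ k, (v k : ℝ) ≤ K) ∧
      (∑ k, (v k : ℝ) = ∑ i, Var[X i; P]) ∧ ∀ ω, ∑ k, Y k ω ^ 2 = ∑ i, X i ω ^ 2 := by
  classical
  have hP := hX.isProbabilityMeasure
  have hXL : ∀ i, MemLp (X i) 2 P := fun i ↦ (hX.eval i).memLp_two
  let R : Matrix ι ι ℝ := Matrix.of fun i j ↦ cov[X i, X j; P]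
  have hR : R.IsHermitian := by
    ext i j
    simp [R, covariance_comm]
  let b := hR.eigenvectorBasis
  let Y : ι → Ω → ℝ := fun k ω ↦ ∑ i, b k i * X i ω
  have hYG : HasGaussianLaw (fun ω k ↦ Y k ω) P := by
    let L : (ι → ℝ) →L[ℝ] (ι → ℝ) :=
      ContinuousLinearMap.pi fun k ↦ ∑ i, b k i • ContinuousLinearMap.proj i
    convert! hX.map L using 1
    ext ω k
    simp [L, Y]
  have hYc : ∀ k, ∫ ω, Y k ω ∂P = 0 := by
    intro k
    simp only [Y]
    rw [integral_finsetSum _ fun i _ ↦ ((hXL i).integrable (by norm_num)).const_mul _]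
    simp [integral_const_mul, hc]
  have hcov : ∀ k l, cov[Y k, Y l; P] = if k = l then hR.eigenvalues l else 0 := by
    intro k l
    have h1 : cov[Y k, Y l; P] = ∑ i, b k i * ∑ j, R i j * b l j := by
      simp only [Y]
      rw [covariance_fun_sum_fun_sum (fun i ↦ (hXL i).const_mul _) (fun i ↦ (hXL i).const_mul _)]
      refine Finset.sum_congr rfl fun i _ ↦ ?_
      rw [Finset.mul_sum]
      refine Finset.sum_congr rfl fun j _ ↦ ?_
      rw [covariance_const_mul_left, covariance_const_mul_right]
      simp only [R, Matrix.of_apply]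
      ring
    have h2 : ∀ i, ∑ j, R i j * b l j = hR.eigenvalues l * b l i := fun i ↦
      congrFun (hR.mulVec_eigenvectorBasis l) i
    simp_rw [h1, h2]
    have h3 := orthonormal_iff_ite.1 b.orthonormal k l
    simp only [PiLp.inner_apply, RCLike.inner_apply, conj_trivial] at h3
    calc ∑ i, b k i * (hR.eigenvalues l * b l i)
        = hR.eigenvalues l * ∑ i, b l i * b k i := by
          rw [Finset.mul_sum]; exact Finset.sum_congr rfl fun i _ ↦ by ring
      _ = _ := by rw [h3]; split_ifs <;> simp
  have hvar : ∀ k, Var[Y k; P] = hR.eigenvalues k := by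
    intro k
    rw [← covariance_self (hYG.eval k).aemeasurable, hcov, if_pos rfl]
  have hnn : ∀ k, 0 ≤ hR.eigenvalues k := fun k ↦ hvar k ▸ variance_nonneg _ _
  refine ⟨Y, fun k ↦ (hR.eigenvalues k).toNNReal,
    hYG.iIndepFun_of_covariance_eq_zero fun i j hij ↦ by rw [hcov, if_neg hij], fun k ↦ ?_,
    fun k ↦ (hYG.eval k).aemeasurable, fun k ↦ ?_, ?_, fun ω ↦ ?_⟩
  · rw [(hYG.eval k).map_eq_gaussianReal, hYc, hvar]
  · rw [Real.coe_toNNReal _ (hnn k)]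
    have hev : Module.End.HasEigenvalue (Matrix.toLin' R) (hR.eigenvalues k) := by
      refine Module.End.hasEigenvalue_of_hasEigenvector (x := b k)
        ⟨Module.End.mem_eigenspace_iff.2 ?_, ?_⟩
      · rw [Matrix.toLin'_apply]
        exact hR.mulVec_eigenvectorBasis k
      · exact (WithLp.ofLp_eq_zero 2).ne.2 (b.orthonormal.ne_zero k)
    obtain ⟨i, hi⟩ := eigenvalue_mem_ball hev
    rw [Metric.mem_closedBall, Real.dist_eq] at hi
    have h1 := hK i
    rw [← Finset.add_sum_erase _ _ (Finset.mem_univ i)] at h1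
    have h2 : R i i ≤ |cov[X i, X i; P]| := le_abs_self _
    have h3 := (abs_le.1 hi).2
    have h4 : ∑ j ∈ Finset.univ.erase i, ‖R i j‖
      = ∑ j ∈ Finset.univ.erase i, |cov[X i, X j; P]| := rfl
    linarith
  · simp_rw [fun k ↦ Real.coe_toNNReal _ (hnn k)]
    have h := hR.trace_eq_sum_eigenvalues
    simp only [RCLike.ofReal_real_eq_id, id] at h
    rw [← h]
    simp only [Matrix.trace, Matrix.diag, R, Matrix.of_apply]
    exact Finset.sum_congr rfl fun i _ ↦ covariance_self (hX.eval i).aemeasurable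
  · have h := b.sum_sq_norm_inner_right (WithLp.toLp 2 fun i ↦ X i ω)
    rw [EuclideanSpace.norm_sq_eq] at h
    simpa [PiLp.inner_apply, Y, mul_comm] using h

/-- The Laplace transform of `∑ X_i²` is at most that of a `χ²` variable of the same mean, with
`(∑ Var X_i) / K` (possibly fractional) degrees of freedom. -/
lemma integrable_mgf_sum_sq_le {X : ι → Ω → ℝ} (hX : HasGaussianLaw (fun ω i ↦ X i ω) P)
    (hc : ∀ i, ∫ ω, X i ω ∂P = 0) {K : ℝ} (hK0 : 0 < K)
    (hK : ∀ i, ∑ j, |cov[X i, X j; P]| ≤ K) {s : ℝ} (hs : 2 * s * K < 1) :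
    Integrable (fun ω ↦ Real.exp (s * ∑ i, X i ω ^ 2)) P ∧
      mgf (fun ω ↦ ∑ i, X i ω ^ 2) P s
        ≤ Real.exp (-((∑ i, Var[X i; P]) / (2 * K)) * Real.log (1 - 2 * s * K)) := by
  obtain ⟨Y, v, hind, hlaw, hmeas, hvK, hvsum, hsq⟩ := exists_indep_sq_sum hX hc hK
  have hv1 : ∀ k, 2 * s * v k < 1 := by
    intro k
    rcases le_or_gt 0 s with h | h
    · have := mul_le_mul_of_nonneg_left (hvK k) (by positivity : 0 ≤ 2 * s)
      linarith
    · have : 0 ≤ (-s) * (v k : ℝ) := mul_nonneg (by linarith) (v k).2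
      linarith
  have hmk : ∀ k, mgf (fun ω ↦ Y k ω ^ 2) P s = (√(1 - 2 * s * v k))⁻¹ := by
    intro k
    rw [← mgf_sq_gaussianReal (hv1 k), ← hlaw k, integral_map (hmeas k) (by fun_prop)]
    rfl
  have hprod : mgf (fun ω ↦ ∑ i, X i ω ^ 2) P s = ∏ k, (√(1 - 2 * s * v k))⁻¹ := by
    have hind2 : iIndepFun (fun k ω ↦ Y k ω ^ 2) P :=
      hind.comp (fun _ x ↦ x ^ 2) (fun _ ↦ by fun_prop)
    have h := hind2.mgf_sum₀ (t := s) (fun k ↦ (hmeas k).pow_const 2) Finset.univ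
    rw [← Finset.prod_congr rfl fun k _ ↦ hmk k, ← h]
    congr 1
    ext ω
    simp [hsq]
  refine ⟨Integrable.of_integral_ne_zero ?_, ?_⟩
  · change mgf (fun ω ↦ ∑ i, X i ω ^ 2) P s ≠ 0
    rw [hprod]
    refine (Finset.prod_pos fun k _ ↦ ?_).ne'
    have := hv1 k
    exact inv_pos.2 (Real.sqrt_pos.2 (by linarith))
  · rw [hprod, ← hvsum]
    calc ∏ k, (√(1 - 2 * s * v k))⁻¹
        ≤ ∏ k, Real.exp (-(v k / (2 * K)) * Real.log (1 - 2 * s * K)) :=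
          Finset.prod_le_prod (fun _ _ ↦ by positivity)
            fun k _ ↦ inv_sqrt_le_exp (v k).2 (hvK k) hK0 hs
      _ = _ := by
          rw [← Real.exp_sum, ← Finset.sum_mul, Finset.sum_neg_distrib, Finset.sum_div]

/-- Chernoff's bound, with the optimal parameter `s = (1 - 1/x) / (2K)`. -/
lemma chernoff_sum_sq {X : ι → Ω → ℝ} (hX : HasGaussianLaw (fun ω i ↦ X i ω) P)
    (hc : ∀ i, ∫ ω, X i ω ∂P = 0) {K : ℝ} (hK0 : 0 < K)
    (hK : ∀ i, ∑ j, |cov[X i, X j; P]| ≤ K) {x : ℝ} (hx : 0 < x) :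
    (1 ≤ x → P.real {ω | x * ∑ i, Var[X i; P] ≤ ∑ i, X i ω ^ 2}
      ≤ Real.exp (-((∑ i, Var[X i; P]) / (2 * K) * (x - 1 - Real.log x)))) ∧
    (x ≤ 1 → P.real {ω | ∑ i, X i ω ^ 2 ≤ x * ∑ i, Var[X i; P]}
      ≤ Real.exp (-((∑ i, Var[X i; P]) / (2 * K) * (x - 1 - Real.log x)))) := by
  have hP := hX.isProbabilityMeasure
  set T := ∑ i, Var[X i; P]
  let s := (1 - x⁻¹) / (2 * K)
  have hs1 : 1 - 2 * s * K = x⁻¹ := by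
    simp only [s]
    field_simp
    ring
  obtain ⟨hint, hmgf⟩ := integrable_mgf_sum_sq_le hX hc hK0 hK (s := s)
    (by have := inv_pos.2 hx; linarith)
  rw [hs1, Real.log_inv] at hmgf
  have key : Real.exp (-s * (x * T)) * mgf (fun ω ↦ ∑ i, X i ω ^ 2) P s
      ≤ Real.exp (-(T / (2 * K) * (x - 1 - Real.log x))) := by
    refine (mul_le_mul_of_nonneg_left hmgf (Real.exp_pos _).le).trans_eq ?_
    rw [← Real.exp_add]
    congr 1
    simp only [s]
    field_simp
    ring
  refine ⟨fun h1 ↦ (measure_ge_le_exp_mul_mgf _ ?_ hint).trans key,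
    fun h1 ↦ (measure_le_le_exp_mul_mgf _ ?_ hint).trans key⟩
  · have := inv_le_one_of_one_le₀ h1
    exact div_nonneg (by linarith) (by positivity)
  · have := (one_le_inv₀ hx).2 h1
    exact div_nonpos_of_nonpos_of_nonneg (by linarith) (by positivity)

end QuadraticForm

/-! ### Filters with two vanishing moments -/

section Moments

variable {L : ℕ} {c : Fin (L + 1) → ℝ}

/-- The bilinear form attached to a filter with two vanishing moments annihilates every function
of `(q, r)` that is a sum of terms affine in `q` or affine in `r`. -/
lemma sum_sum_affine_eq_zero (h0 : ∑ q, c q = 0) (h1 : ∑ q : Fin (L + 1), ((q : ℕ) : ℝ) * c q = 0)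
    (A B D E : Fin (L + 1) → ℝ) :
    ∑ q, ∑ r, c q * c r * (A q + ((r : ℕ) : ℝ) * B q + D r + ((q : ℕ) : ℝ) * E r) = 0 := by
  have e : ∀ q, ∑ r, c q * c r * (A q + ((r : ℕ) : ℝ) * B q + D r + ((q : ℕ) : ℝ) * E r)
      = c q * (∑ r, c r * D r) + ((q : ℕ) : ℝ) * c q * ∑ r, c r * E r := by
    intro q
    calc ∑ r, c q * c r * (A q + ((r : ℕ) : ℝ) * B q + D r + ((q : ℕ) : ℝ) * E r)
        = c q * A q * (∑ r, c r) + c q * B q * (∑ r : Fin (L + 1), ((r : ℕ) : ℝ) * c r)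
          + c q * (∑ r, c r * D r) + ((q : ℕ) : ℝ) * c q * ∑ r, c r * E r := by
          simp only [Finset.mul_sum, ← Finset.sum_add_distrib]
          exact Finset.sum_congr rfl fun r _ ↦ by ring
      _ = _ := by rw [h0, h1]; ring
  simp_rw [e, Finset.sum_add_distrib, ← Finset.sum_mul, h0, h1]
  ring

lemma sum_sum_sub_add_pow_eq_zero (h0 : ∑ q, c q = 0)
    (h1 : ∑ q : Fin (L + 1), ((q : ℕ) : ℝ) * c q = 0) (s : ℝ) {k : ℕ} (hk : k < 4) :
    ∑ q : Fin (L + 1), ∑ r : Fin (L + 1),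
      c q * c r * (((q : ℕ) : ℝ) - ((r : ℕ) : ℝ) + s) ^ k = 0 := by
  interval_cases k
  · rw [← sum_sum_affine_eq_zero h0 h1 (fun _ ↦ 1) 0 0 0]
    simp
  · rw [← sum_sum_affine_eq_zero h0 h1 (fun q ↦ (q : ℕ) + s) (fun _ ↦ -1) 0 0]
    refine Finset.sum_congr rfl fun q _ ↦ Finset.sum_congr rfl fun r _ ↦ ?_
    simp only [Pi.zero_apply]
    ring
  · rw [← sum_sum_affine_eq_zero h0 h1 (fun q ↦ ((q : ℕ) + s) ^ 2) (fun q ↦ -2 * ((q : ℕ) + s))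
      (fun r ↦ ((r : ℕ) : ℝ) ^ 2) 0]
    refine Finset.sum_congr rfl fun q _ ↦ Finset.sum_congr rfl fun r _ ↦ ?_
    simp only [Pi.zero_apply]
    ring
  · rw [← sum_sum_affine_eq_zero h0 h1 (fun q ↦ ((q : ℕ) + s) ^ 3) (fun q ↦ -3 * ((q : ℕ) + s) ^ 2)
      (fun r ↦ 3 * s * ((r : ℕ) : ℝ) ^ 2 - ((r : ℕ) : ℝ) ^ 3) (fun r ↦ 3 * ((r : ℕ) : ℝ) ^ 2)]
    refine Finset.sum_congr rfl fun q _ ↦ Finset.sum_congr rfl fun r _ ↦ ?_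
    ring

end Moments

/-! ### Positivity of the variance of the filtered series -/

lemma integrableOn_one_sub_cos {H : ℝ} (hH : H ∈ Set.Ioo (0 : ℝ) 1) (t : ℝ) :
    IntegrableOn (fun x : ℝ ↦ (1 - Real.cos (t * x)) * x ^ (-1 - 2 * H)) (Set.Ioi 0) := by
  have hm : ∀ s : Set ℝ, AEStronglyMeasurable
      (fun x : ℝ ↦ (1 - Real.cos (t * x)) * x ^ (-1 - 2 * H)) (volume.restrict s) := fun s ↦
    Measurable.aestronglyMeasurable (by fun_prop)
  rw [← Set.Ioc_union_Ioi_eq_Ioi (zero_le_one' ℝ)]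
  refine IntegrableOn.union ?_ ?_
  · have h : IntegrableOn (fun x : ℝ ↦ t ^ 2 / 2 * x ^ (1 - 2 * H)) (Set.Ioc 0 1) := by
      rw [← intervalIntegrable_iff_integrableOn_Ioc_of_le zero_le_one]
      exact (intervalIntegral.intervalIntegrable_rpow' (by linarith [hH.2])).const_mul _
    refine Integrable.mono' h (hm _) ?_
    refine (ae_restrict_iff' measurableSet_Ioc).2 (.of_forall fun x hx ↦ ?_)
    have hx0 : 0 < x := hx.1
    rw [Real.norm_of_nonneg (mul_nonneg (by linarith [Real.cos_le_one (t * x)]) (by positivity))]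
    calc (1 - Real.cos (t * x)) * x ^ (-1 - 2 * H)
        ≤ ((t * x) ^ 2 / 2) * x ^ (-1 - 2 * H) := by
          gcongr
          linarith [Real.one_sub_sq_div_two_le_cos (x := t * x)]
      _ = t ^ 2 / 2 * (x ^ (2 : ℝ) * x ^ (-1 - 2 * H)) := by
          rw [Real.rpow_two]; ring
      _ = _ := by
          rw [← Real.rpow_add hx0]
          congr 2
          ring
  · have h : IntegrableOn (fun x : ℝ ↦ 2 * x ^ (-1 - 2 * H)) (Set.Ioi 1) :=
      (integrableOn_Ioi_rpow_of_lt (by linarith [hH.1]) one_pos).const_mul 2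
    refine Integrable.mono' h (hm _) ?_
    refine (ae_restrict_iff' measurableSet_Ioi).2 (.of_forall fun x hx ↦ ?_)
    have hx0 : 0 < x := one_pos.trans hx
    rw [Real.norm_of_nonneg (mul_nonneg (by linarith [Real.cos_le_one (t * x)]) (by positivity))]
    gcongr
    linarith [Real.neg_one_le_cos (t * x)]

/-- The spectral representation `|t|^{2H} = c_H⁻¹ ∫_0^∞ (1 - cos (t x)) x^{-1-2H} dx`, by scaling. -/
lemma integral_one_sub_cos_mul_rpow {H : ℝ} (hH : H ∈ Set.Ioo (0 : ℝ) 1) (t : ℝ) :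
    ∫ x in Set.Ioi (0 : ℝ), (1 - Real.cos (t * x)) * x ^ (-1 - 2 * H)
      = |t| ^ (2 * H) * ∫ x in Set.Ioi (0 : ℝ), (1 - Real.cos x) * x ^ (-1 - 2 * H) := by
  rcases eq_or_ne t 0 with rfl | ht
  · have : 2 * H ≠ 0 := by have := hH.1; positivity
    simp [Real.zero_rpow this]
  have ht' : 0 < |t| := abs_pos.2 ht
  have h := integral_comp_mul_left_Ioi
    (fun y : ℝ ↦ (1 - Real.cos y) * y ^ (-1 - 2 * H)) 0 ht'
  rw [mul_zero, smul_eq_mul] at h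
  have h2 : ∫ x in Set.Ioi (0 : ℝ), (1 - Real.cos (|t| * x)) * (|t| * x) ^ (-1 - 2 * H)
      = |t| ^ (-1 - 2 * H)
        * ∫ x in Set.Ioi (0 : ℝ), (1 - Real.cos (t * x)) * x ^ (-1 - 2 * H) := by
    rw [← integral_const_mul]
    refine setIntegral_congr_fun measurableSet_Ioi fun x hx ↦ ?_
    have hc : Real.cos (|t| * x) = Real.cos (t * x) := by
      rw [← Real.cos_abs (t * x), abs_mul, abs_of_pos (Set.mem_Ioi.1 hx)]
    simp only [hc, Real.mul_rpow ht'.le (le_of_lt hx)]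
    ring
  rw [h2] at h
  have h3 : |t| ^ (-1 - 2 * H) = |t|⁻¹ * (|t| ^ (2 * H))⁻¹ := by
    rw [sub_eq_add_neg, Real.rpow_add ht', Real.rpow_neg_one, Real.rpow_neg ht'.le]
  rw [h3, mul_assoc] at h
  have h4 := mul_left_cancel₀ (inv_ne_zero ht'.ne') h
  rw [← h4, mul_inv_cancel_left₀ (Real.rpow_pos_of_pos ht' _).ne']

/-- A trigonometric polynomial that vanishes on the half-line is zero. -/
lemma exists_trig_ne_zero {L : ℕ} {c : Fin (L + 1) → ℝ} (hc : c ≠ 0) :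
    ∃ x : ℝ, 0 < x ∧ 0 < (∑ q : Fin (L + 1), c q * Real.cos ((q : ℕ) * x)) ^ 2
      + (∑ q : Fin (L + 1), c q * Real.sin ((q : ℕ) * x)) ^ 2 := by
  by_contra! hcon
  let p : Polynomial ℂ := ∑ q : Fin (L + 1), Polynomial.C (c q : ℂ) * Polynomial.X ^ (q : ℕ)
  have hroot : ∀ x : ℝ, 0 < x → p.IsRoot (Complex.exp (x * Complex.I)) := by
    intro x hx
    have h := hcon x hx
    have hcos : ∑ q : Fin (L + 1), c q * Real.cos ((q : ℕ) * x) = 0 := by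
      rw [← sq_eq_zero_iff]
      exact le_antisymm (by nlinarith [sq_nonneg (∑ q : Fin (L + 1), c q * Real.sin ((q : ℕ) * x))])
        (sq_nonneg _)
    have hsin : ∑ q : Fin (L + 1), c q * Real.sin ((q : ℕ) * x) = 0 := by
      rw [hcos] at h
      rw [← sq_eq_zero_iff]
      exact le_antisymm (by linarith) (sq_nonneg _)
    have e : ∀ q : Fin (L + 1), (c q : ℂ) * Complex.exp (x * Complex.I) ^ (q : ℕ)
        = ((c q * Real.cos ((q : ℕ) * x) : ℝ) : ℂ)
          + ((c q * Real.sin ((q : ℕ) * x) : ℝ) : ℂ) * Complex.I := by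
      intro q
      rw [← Complex.exp_nat_mul, ← mul_assoc, Complex.exp_mul_I]
      push_cast
      ring
    simp only [p, Polynomial.IsRoot, Polynomial.eval_finsetSum, Polynomial.eval_mul,
      Polynomial.eval_C, Polynomial.eval_pow, Polynomial.eval_X, e, Finset.sum_add_distrib,
      ← Finset.sum_mul, ← Complex.ofReal_sum, hcos, hsin]
    simp
  have hp : p = 0 := by
    refine Polynomial.eq_zero_of_infinite_isRoot p ?_
    refine Set.infinite_of_injOn_mapsTo (s := Set.Ioo (0 : ℝ) 1)
      (f := fun x : ℝ ↦ Complex.exp (x * Complex.I)) ?_ (fun x hx ↦ hroot x hx.1)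
      (Set.Ioo_infinite one_pos)
    intro x hx y hy hxy
    have h := congrArg Complex.re hxy
    simp only [Complex.exp_ofReal_mul_I_re] at h
    have hpi := Real.pi_gt_three
    exact Real.injOn_cos ⟨hx.1.le, by linarith [hx.2]⟩ ⟨hy.1.le, by linarith [hy.2]⟩ h
  apply hc
  ext q
  have h := congrArg (fun p : Polynomial ℂ ↦ p.coeff (q : ℕ)) hp
  simp only [p, Polynomial.finsetSum_coeff, Polynomial.coeff_C_mul_X_pow, Polynomial.coeff_zero,
    Fin.val_inj, Finset.sum_ite_eq, Finset.mem_univ, if_true] at h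
  exact_mod_cast h

/-- The filtered series is not degenerate: the spectral representation exhibits its variance as the
integral of the squared modulus of a non-zero trigonometric polynomial. -/
lemma covFun_zero_pos {L : ℕ} {c : Fin (L + 1) → ℝ} (h0 : ∑ q, c q = 0) (hc : c ≠ 0) {H : ℝ}
    (hH : H ∈ Set.Ioo (0 : ℝ) 1) : 0 < covFun c H 0 := by
  set J := ∫ x in Set.Ioi (0 : ℝ), (1 - Real.cos x) * x ^ (-1 - 2 * H)
  let W : ℝ → ℝ := fun x ↦ ((∑ q : Fin (L + 1), c q * Real.cos ((q : ℕ) * x)) ^ 2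
      + (∑ q : Fin (L + 1), c q * Real.sin ((q : ℕ) * x)) ^ 2) * x ^ (-1 - 2 * H)
  have hJ0 : 0 ≤ J := setIntegral_nonneg measurableSet_Ioi fun x hx ↦
    mul_nonneg (by linarith [Real.cos_le_one x]) (Real.rpow_nonneg (le_of_lt hx) _)
  have hterm : ∀ q r : Fin (L + 1), IntegrableOn (fun x : ℝ ↦ c q * c r *
      ((1 - Real.cos ((((q : ℕ) : ℝ) - ((r : ℕ) : ℝ)) * x)) * x ^ (-1 - 2 * H))) (Set.Ioi 0) :=
    fun q r ↦ (integrableOn_one_sub_cos hH _).const_mul _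
  have hW : ∀ x, -∑ q : Fin (L + 1), ∑ r : Fin (L + 1), c q * c r *
      ((1 - Real.cos ((((q : ℕ) : ℝ) - ((r : ℕ) : ℝ)) * x)) * x ^ (-1 - 2 * H)) = W x := by
    intro x
    have e : ∀ q r : Fin (L + 1), c q * c r *
        ((1 - Real.cos ((((q : ℕ) : ℝ) - ((r : ℕ) : ℝ)) * x)) * x ^ (-1 - 2 * H))
        = x ^ (-1 - 2 * H) * (c q * c r) - x ^ (-1 - 2 * H)
          * ((c q * Real.cos ((q : ℕ) * x)) * (c r * Real.cos ((r : ℕ) * x))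
            + (c q * Real.sin ((q : ℕ) * x)) * (c r * Real.sin ((r : ℕ) * x))) := by
      intro q r
      rw [sub_mul ((q : ℕ) : ℝ), Real.cos_sub]
      ring
    simp_rw [e, Finset.sum_sub_distrib, ← Finset.mul_sum, Finset.sum_add_distrib,
      ← Finset.mul_sum, ← Finset.sum_mul, h0, W]
    ring
  have hWint : IntegrableOn W (Set.Ioi 0) := by
    have h := (integrable_finsetSum Finset.univ fun q _ ↦
      integrable_finsetSum Finset.univ fun r _ ↦ hterm q r).neg
    exact h.congr (.of_forall hW)
  have hrep : J * covFun c H 0 = 1 / 2 * ∫ x in Set.Ioi (0 : ℝ), W x := by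
    have h1 : ∫ x in Set.Ioi (0 : ℝ), W x = -∑ q : Fin (L + 1), ∑ r : Fin (L + 1), c q * c r *
        (|((q : ℕ) : ℝ) - ((r : ℕ) : ℝ)| ^ (2 * H) * J) := by
      simp_rw [← hW]
      rw [integral_neg, integral_finsetSum _ fun q _ ↦
        integrable_finsetSum Finset.univ fun r _ ↦ hterm q r]
      congr 1
      refine Finset.sum_congr rfl fun q _ ↦ ?_
      rw [integral_finsetSum _ fun r _ ↦ hterm q r]
      refine Finset.sum_congr rfl fun r _ ↦ ?_
      rw [integral_const_mul, integral_one_sub_cos_mul_rpow hH]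
    rw [h1]
    simp only [covFun, Int.cast_zero, add_zero, Finset.mul_sum, mul_neg, ← Finset.sum_neg_distrib]
    refine Finset.sum_congr rfl fun q _ ↦ Finset.sum_congr rfl fun r _ ↦ by ring
  have hWnn : ∀ x ∈ Set.Ioi (0 : ℝ), 0 ≤ W x := fun x hx ↦
    mul_nonneg (by positivity) (Real.rpow_nonneg (le_of_lt hx) _)
  have hWpos : 0 < ∫ x in Set.Ioi (0 : ℝ), W x := by
    refine lt_of_le_of_ne (setIntegral_nonneg measurableSet_Ioi hWnn) fun h ↦ ?_
    have h1 := (setIntegral_eq_zero_iff_of_nonneg_ae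
      ((ae_restrict_iff' measurableSet_Ioi).2 (.of_forall hWnn)) hWint).1 h.symm
    have hcont : ContinuousOn W (Set.Ioi 0) := by
      refine ContinuousOn.mul (by fun_prop) fun x hx ↦ ?_
      exact (Real.continuousAt_rpow_const x _ (.inl (ne_of_gt hx))).continuousWithinAt
    have h2 := Measure.eqOn_open_of_ae_eq h1 isOpen_Ioi hcont continuousOn_const
    obtain ⟨x, hx, hxpos⟩ := exists_trig_ne_zero hc
    exact (mul_pos hxpos (Real.rpow_pos_of_pos hx _)).ne' (h2 hx)
  have : 0 < J * covFun c H 0 := by rw [hrep]; positivity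
  exact pos_of_mul_pos_right this hJ0

/-! ### Uniform summability of the correlations -/

section Decay

variable {L : ℕ} {c : Fin (L + 1) → ℝ}

/-- Since `π_H(0)` vanishes at `H = 1` with derivative `-τ ≠ 0` and is positive on `(0, 1)`, up to
the left end point, it is bounded below by a multiple of `1 - H`. -/
lemma exists_mul_one_sub_le_covFun_zero (h0 : ∑ q, c q = 0)
    (h1 : ∑ q : Fin (L + 1), ((q : ℕ) : ℝ) * c q = 0) (hc : c ≠ 0) (htau : tau c ≠ 0) :
    ∃ m > 0, ∀ H ∈ Set.Ioo (0 : ℝ) 1, m * (1 - H) ≤ covFun c H 0 := by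
  -- The diagonal terms are `0 ^ (2 * H)`, which is discontinuous at `H = 0`: they are left out.
  let F : ℝ → ℝ := fun H ↦ -(1 / 2) * ∑ q : Fin (L + 1), ∑ r : Fin (L + 1), if q = r then 0 else
    c q * c r * |((q : ℕ) : ℝ) - ((r : ℕ) : ℝ)| ^ (2 * H)
  have hFc : ∀ H, 0 < H → F H = covFun c H 0 := by
    intro H hH
    simp only [F, covFun, Int.cast_zero, add_zero]
    congr 1
    refine Finset.sum_congr rfl fun q _ ↦ Finset.sum_congr rfl fun r _ ↦ ?_
    split_ifs with h
    · subst h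
      have : 2 * H ≠ 0 := by positivity
      simp [Real.zero_rpow this]
    · rfl
  have hne : ∀ q r : Fin (L + 1), q ≠ r → 0 < |((q : ℕ) : ℝ) - ((r : ℕ) : ℝ)| := by
    intro q r h
    refine abs_pos.2 (sub_ne_zero.2 fun h' ↦ h (Fin.ext ?_))
    exact_mod_cast h'
  have hderiv : ∀ H, HasDerivAt F (-(1 / 2) * ∑ q : Fin (L + 1), ∑ r : Fin (L + 1),
      if q = r then 0 else c q * c r * (|((q : ℕ) : ℝ) - ((r : ℕ) : ℝ)| ^ (2 * H)
        * (2 * Real.log |((q : ℕ) : ℝ) - ((r : ℕ) : ℝ)|))) H := by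
    intro H
    refine HasDerivAt.const_mul _ ?_
    refine HasDerivAt.fun_sum fun q _ ↦ HasDerivAt.fun_sum fun r _ ↦ ?_
    split_ifs with h
    · exact hasDerivAt_const _ _
    · refine HasDerivAt.const_mul _ ?_
      have h2 := ((hasDerivAt_id H).const_mul 2).const_rpow (hne q r h)
      simp only [id, mul_one] at h2
      convert! h2 using 1
      ring
  have hF1 : F 1 = 0 := by
    rw [hFc 1 one_pos, covFun]
    have := sum_sum_sub_add_pow_eq_zero h0 h1 ((0 : ℤ) : ℝ) (k := 2) (by norm_num)
    simp_rw [mul_one, Real.rpow_two, sq_abs, this]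
    ring
  have hF'1 : deriv F 1 = -tau c := by
    rw [(hderiv 1).deriv, tau, neg_mul, Finset.mul_sum]
    congr 1
    refine Finset.sum_congr rfl fun q _ ↦ ?_
    rw [Finset.mul_sum]
    refine Finset.sum_congr rfl fun r _ ↦ ?_
    split_ifs with h
    · subst h; simp
    · rw [mul_one, Real.rpow_two, sq_abs]; ring
  let G : ℝ → ℝ := dslope F 1
  have hGc : Continuous G := by
    refine continuous_iff_continuousAt.2 fun H ↦ ?_
    rcases eq_or_ne H 1 with rfl | h
    · exact continuousAt_dslope_same.2 (hderiv _).differentiableAt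
    · exact (continuousAt_dslope_of_ne h).2 (hderiv _).continuousAt
  have hG : ∀ H, H ≠ 1 → -G H * (1 - H) = F H := by
    intro H h
    have h' : 1 - H ≠ 0 := sub_ne_zero.2 h.symm
    have h'' : H - 1 ≠ 0 := sub_ne_zero.2 h
    simp only [G, dslope_of_ne F h, slope_def_field, hF1]
    field_simp
    ring
  have hGneg : ∀ H ∈ Set.Ioo (0 : ℝ) 1, 0 < -G H := by
    intro H hH
    have h := hG H hH.2.ne
    rw [hFc H hH.1] at h
    exact pos_of_mul_pos_left (h ▸ covFun_zero_pos h0 hc hH) (by linarith [hH.2])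
  have hGpos : ∀ H ∈ Set.Icc (0 : ℝ) 1, 0 < -G H := by
    intro H hH
    rcases hH.1.eq_or_lt with rfl | h0'
    · have hF0 : F 0 = 1 / 2 * ∑ q, c q ^ 2 := by
        have : ∀ q r : Fin (L + 1), (if q = r then 0 else
            c q * c r * |((q : ℕ) : ℝ) - ((r : ℕ) : ℝ)| ^ (2 * (0 : ℝ)))
            = c q * c r - if q = r then c q * c r else 0 := by
          intro q r
          split_ifs <;> simp
        simp only [F, this, Finset.sum_sub_distrib, Finset.sum_ite_eq, Finset.mem_univ, if_true,
          ← Finset.mul_sum, h0]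
        simp [pow_two]
      have h := hG 0 (by norm_num)
      rw [sub_zero, mul_one] at h
      rw [h, hF0]
      obtain ⟨q, hq⟩ := Function.ne_iff.1 hc
      have : 0 < ∑ q, c q ^ 2 := Finset.sum_pos' (fun _ _ ↦ sq_nonneg _)
        ⟨q, Finset.mem_univ _, by simpa [sq_pos_iff] using hq⟩
      positivity
    rcases hH.2.eq_or_lt with rfl | h1'
    · have hlim : Tendsto (fun H ↦ -G H) (𝓝[<] 1) (𝓝 (-G 1)) :=
        (hGc.neg.tendsto 1).mono_left nhdsWithin_le_nhds
      have h2 : 0 ≤ -G 1 := by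
        refine ge_of_tendsto hlim ?_
        filter_upwards [Ioo_mem_nhdsLT (zero_lt_one' ℝ)] with H hH using (hGneg H hH).le
      refine lt_of_le_of_ne h2 fun h3 ↦ htau ?_
      simp only [G, dslope_same, hF'1, neg_neg] at h3
      exact h3.symm
    · exact hGneg H ⟨h0', h1'⟩
  obtain ⟨H₀, hH₀, hmin⟩ := isCompact_Icc.exists_isMinOn (Set.nonempty_Icc.2 (zero_le_one' ℝ))
    hGc.neg.continuousOn
  refine ⟨-G H₀, hGpos _ hH₀, fun H hH ↦ ?_⟩
  rw [← hFc H hH.1, ← hG H hH.2.ne]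
  have h : -G H₀ ≤ -G H := hmin (Set.Ioo_subset_Icc_self hH)
  exact mul_le_mul_of_nonneg_right h (by linarith [hH.2])

lemma abs_abs_int_rpow_sub_sq_le (z : ℤ) {H : ℝ} (hH : H ∈ Set.Ioo (0 : ℝ) 1) :
    |(|(z : ℝ)| ^ (2 * H) - (z : ℝ) ^ 2)| ≤ 2 * Real.log |(z : ℝ)| * (z : ℝ) ^ 2 * (1 - H) := by
  rcases eq_or_ne z 0 with rfl | hz
  · have : 2 * H ≠ 0 := by have := hH.1; positivity
    simp [Real.zero_rpow this]
  have hz1 : 1 ≤ |(z : ℝ)| := by exact_mod_cast Int.one_le_abs hz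
  have hz0 : 0 < |(z : ℝ)| := by linarith
  have hle : |(z : ℝ)| ^ (2 * H) ≤ (z : ℝ) ^ 2 := by
    rw [← sq_abs, ← Real.rpow_two]
    exact Real.rpow_le_rpow_of_exponent_le hz1 (by linarith [hH.2])
  rw [abs_sub_comm, abs_of_nonneg (by linarith)]
  have e : |(z : ℝ)| ^ (2 * H) = (z : ℝ) ^ 2 * Real.exp (-(2 * Real.log |(z : ℝ)| * (1 - H))) := by
    rw [← sq_abs, ← Real.rpow_two, Real.rpow_def_of_pos hz0, Real.rpow_def_of_pos hz0,
      ← Real.exp_add]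
    congr 1
    ring
  rw [e]
  have h := Real.add_one_le_exp (-(2 * Real.log |(z : ℝ)| * (1 - H)))
  nlinarith [sq_nonneg (z : ℝ)]

lemma exists_abs_covFun_le (h0 : ∑ q, c q = 0)
    (h1 : ∑ q : Fin (L + 1), ((q : ℕ) : ℝ) * c q = 0) (j : ℤ) :
    ∃ A, ∀ H ∈ Set.Ioo (0 : ℝ) 1, |covFun c H j| ≤ A * (1 - H) := by
  refine ⟨1 / 2 * ∑ q : Fin (L + 1), ∑ r : Fin (L + 1), |c q * c r| *
    (2 * Real.log |((((q : ℕ) : ℤ) - ((r : ℕ) : ℤ) + j : ℤ) : ℝ)|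
      * ((((q : ℕ) : ℤ) - ((r : ℕ) : ℤ) + j : ℤ) : ℝ) ^ 2), fun H hH ↦ ?_⟩
  have hz := sum_sum_sub_add_pow_eq_zero h0 h1 (j : ℝ) (k := 2) (by norm_num)
  have e : covFun c H j = -(1 / 2) * ∑ q : Fin (L + 1), ∑ r : Fin (L + 1), c q * c r *
      (|((((q : ℕ) : ℤ) - ((r : ℕ) : ℤ) + j : ℤ) : ℝ)| ^ (2 * H)
        - ((((q : ℕ) : ℤ) - ((r : ℕ) : ℤ) + j : ℤ) : ℝ) ^ 2) := by
    simp only [mul_sub, Finset.sum_sub_distrib]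
    push_cast
    rw [hz, covFun, mul_zero, sub_zero]
  rw [e, abs_mul, mul_assoc, Finset.sum_mul]
  refine mul_le_mul (by norm_num) ?_ (abs_nonneg _) (by norm_num)
  refine (Finset.abs_sum_le_sum_abs _ _).trans (Finset.sum_le_sum fun q _ ↦ ?_)
  rw [Finset.sum_mul]
  refine (Finset.abs_sum_le_sum_abs _ _).trans (Finset.sum_le_sum fun r _ ↦ ?_)
  rw [abs_mul, mul_assoc]
  exact mul_le_mul_of_nonneg_left (abs_abs_int_rpow_sub_sq_le _ hH) (abs_nonneg _)

/-- Third-order Taylor expansion of `x ↦ x ^ (2H)`; the factor `1 - H` in the remainder comes from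
the fourth derivative. -/
lemma exists_cubic_approx_rpow {H : ℝ} (hH : H ∈ Set.Ioo (0 : ℝ) 1) {a b : ℝ} (ha : 1 ≤ a)
    (hab : a < b) : ∃ t : ℕ → ℝ, ∀ x ∈ Set.Icc a b,
      |x ^ (2 * H) - ∑ k ∈ Finset.range 4, t k * (x - a) ^ k|
        ≤ 2 * (1 - H) * (b - a) ^ 4 / a ^ 2 := by
  let f : ℝ → ℝ := fun x ↦ x ^ (2 * H)
  have hcd : ∀ x ∈ Set.Icc a b, ContDiffAt ℝ 4 f x := fun x hx ↦
    Real.contDiffAt_rpow_const_of_ne (by linarith [hx.1])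
  refine ⟨fun k ↦ (k.factorial : ℝ)⁻¹ * iteratedDerivWithin k f (Set.Icc a b) a, fun x hx ↦ ?_⟩
  have hbound : ∀ y ∈ Set.Icc a b,
      ‖iteratedDerivWithin (3 + 1) f (Set.Icc a b) y‖ ≤ 12 * (1 - H) / a ^ 2 := by
    intro y hy
    have hy1 : 1 ≤ y := ha.trans hy.1
    rw [iteratedDerivWithin_eq_iteratedDeriv (uniqueDiffOn_Icc hab) (hcd y hy) hy,
      iteratedDeriv_eq_iterate, Real.iter_deriv_rpow_const, Real.norm_eq_abs, abs_mul,
      abs_of_pos (Real.rpow_pos_of_pos (by linarith) _), div_eq_mul_inv]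
    have e : (descPochhammer ℝ (3 + 1)).eval (2 * H)
        = 2 * H * (2 * H - 1) * (2 * H - 2) * (2 * H - 3) := by
      simp [descPochhammer_succ_right]
    rw [e]
    have hH0 := hH.1
    have hH1 := hH.2
    refine mul_le_mul ?_ ?_ (Real.rpow_nonneg (by linarith) _) (by linarith)
    · rw [abs_mul, abs_mul, abs_mul, abs_of_pos (by linarith : 0 < 2 * H),
        abs_of_neg (by linarith : 2 * H - 2 < 0), abs_of_neg (by linarith : 2 * H - 3 < 0)]
      have h1 : |2 * H - 1| ≤ 1 := abs_le.2 ⟨by linarith, by linarith⟩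
      calc 2 * H * |2 * H - 1| * -(2 * H - 2) * -(2 * H - 3)
          ≤ 2 * 1 * -(2 * H - 2) * 3 := by gcongr <;> linarith
        _ = _ := by ring
    · calc y ^ (2 * H - ((3 + 1 : ℕ) : ℝ)) ≤ y ^ (-2 : ℝ) :=
          Real.rpow_le_rpow_of_exponent_le hy1 (by push_cast; linarith)
        _ = (y ^ 2)⁻¹ := by rw [Real.rpow_neg (by linarith), Real.rpow_two]
        _ ≤ (a ^ 2)⁻¹ := by
          have := hy.1
          gcongr
  have h := taylor_mean_remainder_bound hab.le
    (fun x hx ↦ (hcd x hx).contDiffWithinAt) hx hbound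
  rw [taylor_within_apply, Real.norm_eq_abs] at h
  have e : ∑ k ∈ Finset.range 4,
      (k.factorial : ℝ)⁻¹ * iteratedDerivWithin k f (Set.Icc a b) a * (x - a) ^ k
      = ∑ k ∈ Finset.range (3 + 1),
        ((k.factorial : ℝ)⁻¹ * (x - a) ^ k) • iteratedDerivWithin k f (Set.Icc a b) a :=
    Finset.sum_congr rfl fun k _ ↦ by rw [smul_eq_mul]; ring
  rw [e]
  refine h.trans ?_
  have hx1 := hx.1
  have hx2 := hx.2
  have hpow : (x - a) ^ (3 + 1) ≤ (b - a) ^ 4 := by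
    have : 0 ≤ x - a := by linarith
    gcongr
  have hfac : ((3 : ℕ).factorial : ℝ) = 6 := by norm_num [Nat.factorial]
  rw [hfac]
  have hH1 : 0 ≤ 1 - H := by linarith [hH.2]
  calc 12 * (1 - H) / a ^ 2 * (x - a) ^ (3 + 1) / 6
      ≤ 12 * (1 - H) / a ^ 2 * (b - a) ^ 4 / 6 := by gcongr
    _ = _ := by ring

lemma covFun_neg (H : ℝ) (j : ℤ) : covFun c H (-j) = covFun c H j := by
  rw [covFun, covFun, Finset.sum_comm]
  congr 1
  refine Finset.sum_congr rfl fun q _ ↦ Finset.sum_congr rfl fun r _ ↦ ?_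
  rw [mul_comm (c r), ← abs_neg]
  congr 3
  push_cast
  ring

/-- For large lags the covariance is a fourth-order difference of `x ↦ x ^ (2H)`. -/
lemma exists_abs_covFun_le_div_sq (h0 : ∑ q, c q = 0)
    (h1 : ∑ q : Fin (L + 1), ((q : ℕ) : ℝ) * c q = 0) :
    ∃ A, 0 ≤ A ∧ ∀ H ∈ Set.Ioo (0 : ℝ) 1, ∀ j : ℤ, 2 * (L : ℤ) + 2 ≤ |j| →
      |covFun c H j| ≤ A / (j : ℝ) ^ 2 * (1 - H) := by
  let S := ∑ q : Fin (L + 1), ∑ r : Fin (L + 1), |c q * c r|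
  have hS : 0 ≤ S := Finset.sum_nonneg fun q _ ↦ Finset.sum_nonneg fun r _ ↦ abs_nonneg _
  refine ⟨4 * (2 * (L : ℝ) + 1) ^ 4 * S, by positivity, fun H hH ↦ ?_⟩
  have main : ∀ j : ℤ, 2 * (L : ℤ) + 2 ≤ j →
      |covFun c H j| ≤ 4 * (2 * (L : ℝ) + 1) ^ 4 * S / (j : ℝ) ^ 2 * (1 - H) := by
    intro j hj
    have hj' : 2 * (L : ℝ) + 2 ≤ j := by exact_mod_cast hj
    have hL : (0 : ℝ) ≤ L := Nat.cast_nonneg _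
    set a : ℝ := j - L with ha
    obtain ⟨t, ht⟩ := exists_cubic_approx_rpow hH (a := a) (b := a + (2 * L + 1))
      (by linarith) (by linarith)
    rw [add_sub_cancel_left] at ht
    have hx : ∀ q r : Fin (L + 1), ((q : ℕ) : ℝ) - ((r : ℕ) : ℝ) + j
        ∈ Set.Icc a (a + (2 * L + 1)) := by
      intro q r
      have hq : ((q : ℕ) : ℝ) ≤ L := by exact_mod_cast Nat.le_of_lt_succ q.2
      have hr : ((r : ℕ) : ℝ) ≤ L := by exact_mod_cast Nat.le_of_lt_succ r.2
      have hq0 : (0 : ℝ) ≤ ((q : ℕ) : ℝ) := Nat.cast_nonneg _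
      have hr0 : (0 : ℝ) ≤ ((r : ℕ) : ℝ) := Nat.cast_nonneg _
      constructor <;> simp only [ha] <;> linarith
    have hzero : ∑ q : Fin (L + 1), ∑ r : Fin (L + 1), c q * c r *
        ∑ k ∈ Finset.range 4, t k * (((q : ℕ) : ℝ) - ((r : ℕ) : ℝ) + j - a) ^ k = 0 := by
      simp_rw [Finset.mul_sum]
      rw [Finset.sum_congr rfl fun q _ ↦ Finset.sum_comm, Finset.sum_comm]
      refine Finset.sum_eq_zero fun k hk ↦ ?_
      rw [← mul_zero (t k), ← sum_sum_sub_add_pow_eq_zero h0 h1 (L : ℝ) (Finset.mem_range.1 hk),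
        Finset.mul_sum]
      refine Finset.sum_congr rfl fun q _ ↦ ?_
      rw [Finset.mul_sum]
      refine Finset.sum_congr rfl fun r _ ↦ ?_
      rw [show ((q : ℕ) : ℝ) - ((r : ℕ) : ℝ) + j - a = ((q : ℕ) : ℝ) - ((r : ℕ) : ℝ) + L by
        rw [ha]; ring]
      ring
    have e : covFun c H j = -(1 / 2) * ∑ q : Fin (L + 1), ∑ r : Fin (L + 1), c q * c r *
        ((((q : ℕ) : ℝ) - ((r : ℕ) : ℝ) + j) ^ (2 * H)
          - ∑ k ∈ Finset.range 4, t k * (((q : ℕ) : ℝ) - ((r : ℕ) : ℝ) + j - a) ^ k) := by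
      simp only [mul_sub, Finset.sum_sub_distrib]
      rw [hzero, covFun, mul_zero, sub_zero]
      congr 1
      refine Finset.sum_congr rfl fun q _ ↦ Finset.sum_congr rfl fun r _ ↦ ?_
      rw [abs_of_nonneg (by linarith [(hx q r).1])]
    have hsum : |∑ q : Fin (L + 1), ∑ r : Fin (L + 1), c q * c r *
        ((((q : ℕ) : ℝ) - ((r : ℕ) : ℝ) + j) ^ (2 * H)
          - ∑ k ∈ Finset.range 4, t k * (((q : ℕ) : ℝ) - ((r : ℕ) : ℝ) + j - a) ^ k)|
        ≤ S * (2 * (1 - H) * (2 * L + 1) ^ 4 / a ^ 2) := by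
      rw [Finset.sum_mul]
      refine (Finset.abs_sum_le_sum_abs _ _).trans (Finset.sum_le_sum fun q _ ↦ ?_)
      rw [Finset.sum_mul]
      refine (Finset.abs_sum_le_sum_abs _ _).trans (Finset.sum_le_sum fun r _ ↦ ?_)
      rw [abs_mul]
      exact mul_le_mul_of_nonneg_left (ht _ (hx q r)) (abs_nonneg _)
    have hH1 : 0 ≤ 1 - H := by linarith [hH.2]
    have hja : (j : ℝ) ^ 2 / 4 ≤ a ^ 2 := by
      have : (j : ℝ) / 2 ≤ a := by rw [ha]; linarith
      calc (j : ℝ) ^ 2 / 4 = ((j : ℝ) / 2) ^ 2 := by ring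
        _ ≤ a ^ 2 := pow_le_pow_left₀ (by linarith) this 2
    have hj0 : 0 < (j : ℝ) := by linarith
    rw [e, abs_mul, show |(-(1 / 2) : ℝ)| = 1 / 2 by norm_num]
    calc 1 / 2 * |_| ≤ 1 / 2 * (S * (2 * (1 - H) * (2 * L + 1) ^ 4 / a ^ 2)) := by gcongr
      _ ≤ 1 / 2 * (S * (2 * (1 - H) * (2 * L + 1) ^ 4 / ((j : ℝ) ^ 2 / 4))) := by gcongr
      _ = _ := by field_simp
  intro j hj
  rcases le_abs'.1 hj with h | h
  · have := main (-j) (by linarith)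
    rw [covFun_neg] at this
    simpa using this
  · exact main j h

/-- The correlations are dominated, uniformly in `H`, by a summable sequence: in the quotient
`π_H(j) / π_H(0)` both terms are of the order of `1 - H` as `H → 1`. -/
lemma exists_summable_bound_corrFun (h0 : ∑ q, c q = 0)
    (h1 : ∑ q : Fin (L + 1), ((q : ℕ) : ℝ) * c q = 0) (hc : c ≠ 0) (htau : tau c ≠ 0) :
    ∃ u : ℤ → ℝ, Summable u ∧ ∀ H ∈ Set.Ioo (0 : ℝ) 1, ∀ j, |corrFun c H j| ≤ u j := by
  obtain ⟨m, hm, hlow⟩ := exists_mul_one_sub_le_covFun_zero h0 h1 hc htau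
  obtain ⟨A, hA, hfar⟩ := exists_abs_covFun_le_div_sq h0 h1
  choose D hD using exists_abs_covFun_le h0 h1
  have hratio : ∀ H ∈ Set.Ioo (0 : ℝ) 1, ∀ (j : ℤ) (E : ℝ),
      |covFun c H j| ≤ E * (1 - H) → |corrFun c H j| ≤ E / m := by
    intro H hH j E h
    have hpos := covFun_zero_pos h0 hc hH
    have hH1 : 0 < 1 - H := by linarith [hH.2]
    rw [corrFun, abs_div, abs_of_pos hpos, div_le_div_iff₀ hpos hm]
    have hE : 0 ≤ E := by
      by_contra! hE
      have := mul_neg_of_neg_of_pos hE hH1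
      linarith [abs_nonneg (covFun c H j)]
    nlinarith [hlow H hH]
  let s := Finset.Icc (-(2 * (L : ℤ) + 2)) (2 * (L : ℤ) + 2)
  refine ⟨fun j ↦ A / m * (1 / (j : ℝ) ^ 2) + if j ∈ s then D j / m else 0, ?_, ?_⟩
  · refine ((Real.summable_one_div_int_pow.2 one_lt_two).mul_left _).add ?_
    exact summable_of_ne_finset_zero (s := s) fun j hj ↦ if_neg hj
  · intro H hH j
    beta_reduce
    split_ifs with hj
    · have h2 : 0 ≤ A / m * (1 / (j : ℝ) ^ 2) := by positivity
      linarith [hratio H hH j _ (hD j H hH)]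
    · have hj' : 2 * (L : ℤ) + 2 ≤ |j| := by
        by_contra! hlt
        exact hj (Finset.mem_Icc.2 (abs_le.1 hlt.le))
      rw [add_zero]
      refine (hratio H hH j _ (hfar H hH j hj')).trans_eq ?_
      ring

lemma corrFun_zero (h0 : ∑ q, c q = 0) (hc : c ≠ 0) {H : ℝ} (hH : H ∈ Set.Ioo (0 : ℝ) 1) :
    corrFun c H 0 = 1 :=
  div_self (covFun_zero_pos h0 hc hH).ne'

/-- The constant `κ` is positive, and `κ / 2` bounds the partial sums of `|ρ_H|` for every `H`. In
particular the supremum and the series in the definition of `κ` are not junk values. -/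
lemma kappa_pos_and_sum_le (h0 : ∑ q, c q = 0)
    (h1 : ∑ q : Fin (L + 1), ((q : ℕ) : ℝ) * c q = 0) (hc : c ≠ 0) (htau : tau c ≠ 0) :
    0 < kappa c ∧ ∀ H ∈ Set.Ioo (0 : ℝ) 1, ∀ s : Finset ℤ,
      ∑ j ∈ s, |corrFun c H j| ≤ kappa c / 2 := by
  obtain ⟨u, hu, hbound⟩ := exists_summable_bound_corrFun h0 h1 hc htau
  have hsum : ∀ H ∈ Set.Ioo (0 : ℝ) 1, Summable fun j ↦ |corrFun c H j| := fun H hH ↦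
    hu.of_nonneg_of_le (fun _ ↦ abs_nonneg _) (hbound H hH)
  have hbdd : BddAbove (Set.range fun H : Set.Ioo (0 : ℝ) 1 ↦
      ∑' j : ℤ, |corrFun c (H : ℝ) j|) := by
    refine ⟨∑' j, u j, ?_⟩
    rintro _ ⟨H, rfl⟩
    exact (hsum H H.2).tsum_le_tsum (hbound H H.2) hu
  have hle : ∀ H ∈ Set.Ioo (0 : ℝ) 1, ∀ s : Finset ℤ,
      ∑ j ∈ s, |corrFun c H j| ≤ kappa c / 2 := by
    intro H hH s
    have h2 := le_ciSup hbdd ⟨H, hH⟩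
    have h3 := (hsum H hH).sum_le_tsum s fun _ _ ↦ abs_nonneg _
    rw [kappa]
    simp only at h2
    linarith
  refine ⟨?_, hle⟩
  have hhalf : (1 / 2 : ℝ) ∈ Set.Ioo (0 : ℝ) 1 := by norm_num
  have h := hle _ hhalf {0}
  rw [Finset.sum_singleton, corrFun_zero h0 hc hhalf, abs_one] at h
  linarith

end Decay

/-! ### Dilated filters -/

section Dilate

variable {ℓ : ℕ} {a : Fin (ℓ + 1) → ℝ} {m : ℕ}

lemma sum_dilate_mul (hm : 1 ≤ m) (f : ℕ → ℝ) :
    ∑ i : Fin (m * ℓ + 1), dilate m a i * f i = ∑ q : Fin (ℓ + 1), a q * f (m * q) := by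
  have hb : ∀ q : Fin (ℓ + 1), m * (q : ℕ) < m * ℓ + 1 := fun q ↦
    Nat.lt_succ_of_le (Nat.mul_le_mul_left m (Nat.le_of_lt_succ q.2))
  symm
  refine Finset.sum_of_injOn (fun q ↦ ⟨m * (q : ℕ), hb q⟩) ?_ (fun _ _ ↦ Finset.mem_coe.2
    (Finset.mem_univ _)) ?_ ?_
  · intro q _ r _ h
    exact Fin.ext (Nat.eq_of_mul_eq_mul_left hm (Fin.mk.inj h))
  · intro i _ hi
    have : ¬ m ∣ (i : ℕ) := by
      rintro ⟨k, hk⟩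
      refine hi ⟨⟨k, ?_⟩, by simp, Fin.ext hk.symm⟩
      have h1 := i.2
      rw [hk] at h1
      exact Nat.lt_succ_of_le (Nat.le_of_mul_le_mul_left (Nat.le_of_lt_succ h1) hm)
    rw [dilate, if_neg this, zero_mul]
  · intro q _
    rw [dilate, if_pos (Dvd.intro _ rfl)]
    congr 3
    simp [Nat.mul_div_cancel_left _ hm]

lemma sum_sum_dilate_mul (hm : 1 ≤ m) (f : ℕ → ℕ → ℝ) :
    ∑ i : Fin (m * ℓ + 1), ∑ k : Fin (m * ℓ + 1), dilate m a i * dilate m a k * f i k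
      = ∑ q : Fin (ℓ + 1), ∑ r : Fin (ℓ + 1), a q * a r * f (m * q) (m * r) := by
  simp_rw [mul_assoc, ← Finset.mul_sum]
  rw [sum_dilate_mul hm fun i ↦ ∑ k : Fin (m * ℓ + 1), dilate m a k * f i k]
  exact Finset.sum_congr rfl fun q _ ↦ by rw [sum_dilate_mul hm fun k ↦ f (m * q) k]

lemma sum_dilate_eq_zero (hm : 1 ≤ m) (h0 : ∑ q, a q = 0) : ∑ i, dilate m a i = 0 := by
  simpa [h0] using sum_dilate_mul (a := a) hm fun _ ↦ 1

lemma sum_mul_dilate_eq_zero (hm : 1 ≤ m) (h1 : ∑ q : Fin (ℓ + 1), ((q : ℕ) : ℝ) * a q = 0) :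
    ∑ i : Fin (m * ℓ + 1), ((i : ℕ) : ℝ) * dilate m a i = 0 := by
  have h := sum_dilate_mul (a := a) hm fun i ↦ (i : ℝ)
  simp_rw [mul_comm ((_ : ℕ) : ℝ) (dilate m a _), h, Nat.cast_mul]
  rw [← mul_zero (m : ℝ), ← h1, Finset.mul_sum]
  exact Finset.sum_congr rfl fun q _ ↦ by ring

lemma dilate_ne_zero (hm : 1 ≤ m) (ha : a ≠ 0) : dilate m a ≠ 0 := by
  intro h
  apply ha
  ext q
  have h2 := sum_dilate_mul (a := a) hm fun i ↦ if i = m * q then 1 else 0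
  have h3 : ∀ r : Fin (ℓ + 1), m * (r : ℕ) = m * q ↔ r = q := fun r ↦
    ⟨fun h ↦ Fin.ext (Nat.eq_of_mul_eq_mul_left hm h), fun h ↦ by rw [h]⟩
  simpa [h, h3] using h2.symm

lemma tau_dilate (hm : 1 ≤ m) (h0 : ∑ q, a q = 0)
    (h1 : ∑ q : Fin (ℓ + 1), ((q : ℕ) : ℝ) * a q = 0) : tau (dilate m a) = (m : ℝ) ^ 2 * tau a := by
  have hm0 : (0 : ℝ) < m := by exact_mod_cast hm
  have hz := sum_sum_sub_add_pow_eq_zero h0 h1 0 (k := 2) (by norm_num)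
  simp only [add_zero] at hz
  have h := sum_sum_dilate_mul (a := a) hm fun i k ↦
    ((i : ℝ) - (k : ℝ)) ^ 2 * Real.log |(i : ℝ) - (k : ℝ)|
  simp only [← mul_assoc] at h
  have e : ∀ q r : Fin (ℓ + 1), a q * a r * (((m * (q : ℕ) : ℕ) : ℝ) - ((m * (r : ℕ) : ℕ) : ℝ)) ^ 2
      * Real.log |((m * (q : ℕ) : ℕ) : ℝ) - ((m * (r : ℕ) : ℕ) : ℝ)|
      = (m : ℝ) ^ 2 * Real.log m * (a q * a r * (((q : ℕ) : ℝ) - ((r : ℕ) : ℝ)) ^ 2)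
        + (m : ℝ) ^ 2 * (a q * a r * (((q : ℕ) : ℝ) - ((r : ℕ) : ℝ)) ^ 2
          * Real.log |((q : ℕ) : ℝ) - ((r : ℕ) : ℝ)|) := by
    intro q r
    rw [Nat.cast_mul, Nat.cast_mul, ← mul_sub]
    rcases eq_or_ne (((q : ℕ) : ℝ) - ((r : ℕ) : ℝ)) 0 with h | h
    · simp [h]
    · rw [abs_mul, abs_of_pos hm0, Real.log_mul hm0.ne' (abs_ne_zero.2 h)]
      ring
  rw [tau, tau, h]
  simp_rw [e, Finset.sum_add_distrib, ← Finset.mul_sum, hz]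
  ring

lemma covFun_dilate_zero (hm : 1 ≤ m) (H : ℝ) :
    covFun (dilate m a) H 0 = (m : ℝ) ^ (2 * H) * covFun a H 0 := by
  have hm0 : (0 : ℝ) < m := by exact_mod_cast hm
  have h := sum_sum_dilate_mul (a := a) hm fun i k ↦
    |(i : ℝ) - (k : ℝ) + ((0 : ℤ) : ℝ)| ^ (2 * H)
  rw [covFun, h, covFun]
  simp only [Finset.mul_sum]
  refine Finset.sum_congr rfl fun q _ ↦ Finset.sum_congr rfl fun r _ ↦ ?_
  rw [Nat.cast_mul, Nat.cast_mul, Int.cast_zero, add_zero, add_zero, ← mul_sub, abs_mul,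
    abs_of_pos hm0, Real.mul_rpow hm0.le (abs_nonneg _)]
  ring

end Dilate

/-! ### The filtered fractional Brownian motion -/

/-- The value of the variance of the filtered series, and of the mean of its quadratic variation,
for a fractional Brownian motion observed at the times `i / n`. -/
def filteredVar {L : ℕ} (c : Fin (L + 1) → ℝ) (H C : ℝ) (n : ℕ) : ℝ :=
  C ^ 2 * ((n : ℝ) ^ (2 * H))⁻¹ * covFun c H 0

section FBM

variable {Ω : Type*} [MeasurableSpace Ω] {P : Measure Ω} {H C : ℝ} {B : ℝ → Ω → ℝ}

lemma IsFractionalBrownianMotion.variance_sub (hH : H ∈ Set.Ioo (0 : ℝ) 1)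
    (hB : IsFractionalBrownianMotion P H C B) (s t : ℝ) :
    Var[fun ω ↦ B t ω - B s ω; P] = C ^ 2 * |t - s| ^ (2 * H) := by
  have := hB.gaussian.isProbabilityMeasure
  have h0 : Var[B 0; P] = 0 := by
    have h2 : 2 * H ≠ 0 := by have := hH.1; positivity
    rw [hB.variance_eq, abs_zero, Real.zero_rpow h2, mul_zero]
  have hB0 : B 0 =ᵐ[P] fun _ ↦ 0 := by
    have h := ae_eq_integral_of_variance_eq_zero (hB.gaussian.hasGaussianLaw_eval 0).memLp_two h0
    rwa [hB.centered] at h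
  have hid := (hB.stationary_increments s {t - s}).comp
    (measurable_pi_apply (⟨t - s, by simp⟩ : ({t - s} : Finset ℝ)))
  have hv := hid.variance_eq
  simp only [Function.comp_def, sub_add_cancel] at hv
  rw [hv, ← hB.variance_eq]
  refine variance_congr ?_
  filter_upwards [hB0] with ω hω
  rw [hω, sub_zero]

lemma IsFractionalBrownianMotion.covariance_eq (hH : H ∈ Set.Ioo (0 : ℝ) 1)
    (hB : IsFractionalBrownianMotion P H C B) (s t : ℝ) :
    cov[B s, B t; P] = 1 / 2 * (Var[B s; P] + Var[B t; P] - C ^ 2 * |t - s| ^ (2 * H)) := by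
  have := hB.gaussian.isProbabilityMeasure
  have h := variance_fun_sub (hB.gaussian.hasGaussianLaw_eval t).memLp_two
    (hB.gaussian.hasGaussianLaw_eval s).memLp_two
  rw [hB.variance_sub hH, covariance_comm] at h
  linarith

variable {L : ℕ} {c : Fin (L + 1) → ℝ}

/-- The filtered series is stationary: the terms depending on one time only are killed by the
vanishing moment of the filter. -/
lemma IsFractionalBrownianMotion.covariance_filtered (hH : H ∈ Set.Ioo (0 : ℝ) 1)
    (hB : IsFractionalBrownianMotion P H C B) (h0 : ∑ q, c q = 0) {n : ℕ} (hn : 0 < n) (i k : ℕ) :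
    cov[fun ω ↦ filtered c n (fun t ↦ B t ω) i, fun ω ↦ filtered c n (fun t ↦ B t ω) k; P]
      = C ^ 2 * ((n : ℝ) ^ (2 * H))⁻¹ * covFun c H ((k : ℤ) - (i : ℤ)) := by
  have := hB.gaussian.isProbabilityMeasure
  have hn0 : (0 : ℝ) < n := by exact_mod_cast hn
  have hL2 : ∀ t, MemLp (B t) 2 P := fun t ↦ (hB.gaussian.hasGaussianLaw_eval t).memLp_two
  simp only [filtered]
  rw [covariance_fun_sum_fun_sum (fun q ↦ (hL2 _).const_mul _) (fun q ↦ (hL2 _).const_mul _)]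
  simp_rw [covariance_const_mul_left, covariance_const_mul_right, hB.covariance_eq hH]
  have e : ∀ q r : Fin (L + 1), c q * (c r * (1 / 2 *
      (Var[B (((i : ℝ) - ((q : ℕ) : ℝ)) / n); P] + Var[B (((k : ℝ) - ((r : ℕ) : ℝ)) / n); P]
        - C ^ 2 * |((k : ℝ) - ((r : ℕ) : ℝ)) / n - ((i : ℝ) - ((q : ℕ) : ℝ)) / n| ^ (2 * H))))
      = (1 / 2 * c q * Var[B (((i : ℝ) - ((q : ℕ) : ℝ)) / n); P]) * c r
        + c q * (1 / 2 * c r * Var[B (((k : ℝ) - ((r : ℕ) : ℝ)) / n); P])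
        - C ^ 2 * ((n : ℝ) ^ (2 * H))⁻¹ * (1 / 2 * (c q * c r *
          |((q : ℕ) : ℝ) - ((r : ℕ) : ℝ) + (((k : ℤ) - (i : ℤ) : ℤ) : ℝ)| ^ (2 * H))) := by
    intro q r
    have h1 : ((k : ℝ) - ((r : ℕ) : ℝ)) / n - ((i : ℝ) - ((q : ℕ) : ℝ)) / n
        = (((q : ℕ) : ℝ) - ((r : ℕ) : ℝ) + (((k : ℤ) - (i : ℤ) : ℤ) : ℝ)) / n := by
      push_cast
      ring
    rw [h1, abs_div, abs_of_pos hn0, Real.div_rpow (abs_nonneg _) hn0.le]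
    ring
  simp_rw [e, Finset.sum_sub_distrib, Finset.sum_add_distrib, ← Finset.mul_sum, ← Finset.sum_mul,
    h0]
  rw [covFun]
  ring

lemma IsFractionalBrownianMotion.isGaussianProcess_filtered
    (hB : IsFractionalBrownianMotion P H C B) (c : Fin (L + 1) → ℝ) (n : ℕ) :
    IsGaussianProcess (fun (i : ℕ) ω ↦ filtered c n (fun t ↦ B t ω) i) P := by
  classical
  refine hB.gaussian.of_isGaussianProcess fun i ↦
    ⟨Finset.univ.image fun q : Fin (L + 1) ↦ ((i : ℝ) - ((q : ℕ) : ℝ)) / (n : ℝ),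
      ∑ q : Fin (L + 1), c q • ContinuousLinearMap.proj
        ⟨((i : ℝ) - ((q : ℕ) : ℝ)) / (n : ℝ), Finset.mem_image_of_mem _ (Finset.mem_univ q)⟩,
      fun ω ↦ ?_⟩
  simp [filtered]

lemma IsFractionalBrownianMotion.integral_filtered (hB : IsFractionalBrownianMotion P H C B)
    (c : Fin (L + 1) → ℝ) (n i : ℕ) : ∫ ω, filtered c n (fun t ↦ B t ω) i ∂P = 0 := by
  simp only [filtered]
  rw [integral_finsetSum _ fun q _ ↦
    (hB.gaussian.hasGaussianLaw_eval _).integrable.const_mul _]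
  simp [integral_const_mul, hB.centered]

lemma filteredVar_pos (hH : H ∈ Set.Ioo (0 : ℝ) 1) (hC : 0 < C) (h0 : ∑ q, c q = 0) (hc : c ≠ 0)
    {n : ℕ} (hn : 0 < n) : 0 < filteredVar c H C n := by
  have := covFun_zero_pos h0 hc hH
  have hn0 : (0 : ℝ) < n := by exact_mod_cast hn
  rw [filteredVar]
  positivity

/-- Exponential concentration of the quadratic variation around its mean. -/
lemma IsFractionalBrownianMotion.quadVar_concentration (hH : H ∈ Set.Ioo (0 : ℝ) 1) (hC : 0 < C)
    (hB : IsFractionalBrownianMotion P H C B) (h0 : ∑ q, c q = 0)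
    (h1 : ∑ q : Fin (L + 1), ((q : ℕ) : ℝ) * c q = 0) (hc : c ≠ 0) (htau : tau c ≠ 0)
    {n : ℕ} (hn : L < n) {x : ℝ} (hx : 0 < x) :
    (1 ≤ x → P.real {ω | x * filteredVar c H C n ≤ quadVar c n (fun t ↦ B t ω)}
      ≤ Real.exp (-(((n : ℝ) - L) / kappa c * (x - 1 - Real.log x)))) ∧
    (x ≤ 1 → P.real {ω | quadVar c n (fun t ↦ B t ω) ≤ x * filteredVar c H C n}
      ≤ Real.exp (-(((n : ℝ) - L) / kappa c * (x - 1 - Real.log x)))) := by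
  obtain ⟨hκ, hsum⟩ := kappa_pos_and_sum_le h0 h1 hc htau
  have hn0 : 0 < n := by omega
  have hN : (0 : ℝ) < (n : ℝ) - L := by
    have : (L : ℝ) < n := by exact_mod_cast hn
    linarith
  set v := filteredVar c H C n with hv
  have hv0 : 0 < v := filteredVar_pos hH hC h0 hc hn0
  let X : Finset.Ico L n → Ω → ℝ := fun i ω ↦ filtered c n (fun t ↦ B t ω) i
  have hXG : HasGaussianLaw (fun ω i ↦ X i ω) P :=
    (hB.isGaussianProcess_filtered c n).hasGaussianLaw (Finset.Ico L n)
  have hcov : ∀ i k, cov[X i, X k; P] = v * corrFun c H ((k : ℕ) - (i : ℕ) : ℤ) := by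
    intro i k
    rw [hB.covariance_filtered hH h0 hn0, hv, filteredVar, corrFun]
    have := (covFun_zero_pos h0 hc hH).ne'
    field_simp
  have hvar : ∀ i, Var[X i; P] = v := by
    intro i
    rw [← covariance_self (hXG.eval i).aemeasurable, hcov, sub_self, corrFun_zero h0 hc hH, mul_one]
  have hrow : ∀ i, ∑ k, |cov[X i, X k; P]| ≤ v * (kappa c / 2) := by
    intro i
    simp_rw [hcov, abs_mul, abs_of_pos hv0, ← Finset.mul_sum]
    refine mul_le_mul_of_nonneg_left ?_ hv0.le
    rw [Finset.sum_coe_sort (Finset.Ico L n) fun k ↦ |corrFun c H ((k : ℕ) - (i : ℕ) : ℤ)|]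
    have hinj : Set.InjOn (fun k : ℕ ↦ ((k : ℤ) - ((i : ℕ) : ℤ))) (Finset.Ico L n) := by
      intro k _ l _ h
      simpa using h
    rw [← Finset.sum_image (f := fun j ↦ |corrFun c H j|) hinj]
    exact hsum H hH _
  have hT : ∑ i, Var[X i; P] = ((n : ℝ) - L) * v := by
    simp [hvar, Nat.cast_sub hn.le]
  have hq : ∀ ω, ∑ i, X i ω ^ 2 = ((n : ℝ) - L) * quadVar c n (fun t ↦ B t ω) := by
    intro ω
    rw [quadVar, Finset.sum_coe_sort (Finset.Ico L n) fun k ↦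
      filtered c n (fun t ↦ B t ω) k ^ 2]
    field_simp
  obtain ⟨hr, hl⟩ := chernoff_sum_sq hXG (fun i ↦ hB.integral_filtered c n i)
    (by positivity) hrow hx
  have hexp : ((n : ℝ) - L) * v / (2 * (v * (kappa c / 2))) = ((n : ℝ) - L) / kappa c := by
    field_simp
  simp_rw [hT, hq, hexp, mul_left_comm x ((n : ℝ) - L) v, mul_le_mul_iff_right₀ hN] at hr hl
  exact ⟨hr, hl⟩

/-- By the Borel-Cantelli lemma, the quadratic variation is almost surely equivalent to its mean. -/
lemma IsFractionalBrownianMotion.ae_tendsto_log_quadVar (hH : H ∈ Set.Ioo (0 : ℝ) 1) (hC : 0 < C)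
    (hB : IsFractionalBrownianMotion P H C B) (h0 : ∑ q, c q = 0)
    (h1 : ∑ q : Fin (L + 1), ((q : ℕ) : ℝ) * c q = 0) (hc : c ≠ 0) (htau : tau c ≠ 0) :
    ∀ᵐ ω ∂P, Tendsto (fun n : ℕ ↦ Real.log (quadVar c n (fun t ↦ B t ω))
      - Real.log (filteredVar c H C n)) atTop (𝓝 0) := by
  have hprob := hB.gaussian.isProbabilityMeasure
  obtain ⟨hκ, -⟩ := kappa_pos_and_sum_le h0 h1 hc htau
  have hBC : ∀ (s : ℕ → Set Ω) (g : ℝ), 0 < g →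
      (∀ n, L < n → P.real (s n) ≤ Real.exp (-(((n : ℝ) - L) / kappa c * g))) →
      ∀ᵐ ω ∂P, ∀ᶠ n in atTop, ω ∉ s n := by
    intro s g hg hs
    refine ae_eventually_notMem ?_
    have hsumm : Summable fun n : ℕ ↦ Real.exp (-(((n : ℝ) - L) / kappa c * g)) := by
      have e : ∀ n : ℕ, Real.exp (-(((n : ℝ) - L) / kappa c * g))
          = Real.exp (L / kappa c * g) * Real.exp (-(g / kappa c)) ^ n := by
        intro n
        rw [← Real.exp_nat_mul, ← Real.exp_add]
        congr 1
        ring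
      simp_rw [e]
      refine (summable_geometric_of_lt_one (Real.exp_pos _).le ?_).mul_left _
      exact Real.exp_lt_one_iff.2 (neg_neg_of_pos (by positivity))
    refine ne_top_of_le_ne_top hsumm.tsum_ofReal_ne_top (ENNReal.tsum_le_tsum fun n ↦ ?_)
    rw [← ofReal_measureReal]
    refine ENNReal.ofReal_le_ofReal ?_
    rcases lt_or_ge L n with h | h
    · exact hs n h
    · refine measureReal_le_one.trans (Real.one_le_exp ?_)
      have h' : (n : ℝ) ≤ L := by exact_mod_cast h
      have : 0 ≤ ((L : ℝ) - n) / kappa c * g :=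
        mul_nonneg (div_nonneg (by linarith) hκ.le) hg.le
      calc (0 : ℝ) ≤ ((L : ℝ) - n) / kappa c * g := this
        _ = _ := by ring
  have hgpos : ∀ x : ℝ, 0 < x → x ≠ 1 → 0 < x - 1 - Real.log x := fun x hx hx1 ↦ by
    have := Real.log_lt_sub_one_of_pos hx hx1
    linarith
  have hδ : ∀ k : ℕ, ∀ᵐ ω ∂P, ∀ᶠ n : ℕ in atTop,
      |Real.log (quadVar c n (fun t ↦ B t ω)) - Real.log (filteredVar c H C n)|
        < 1 / ((k : ℝ) + 1) := by
    intro k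
    set δ : ℝ := 1 / ((k : ℝ) + 1)
    have hδ0 : 0 < δ := by positivity
    have hup := hBC (fun n ↦ {ω | Real.exp δ * filteredVar c H C n ≤ quadVar c n (fun t ↦ B t ω)})
      _ (hgpos (Real.exp δ) (Real.exp_pos _) (Real.one_lt_exp_iff.2 hδ0).ne') fun n hn ↦
        (hB.quadVar_concentration hH hC h0 h1 hc htau hn (Real.exp_pos δ)).1
          (Real.one_lt_exp_iff.2 hδ0).le
    have hlo := hBC (fun n ↦ {ω | quadVar c n (fun t ↦ B t ω) ≤ Real.exp (-δ) * filteredVar c H C n})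
      _ (hgpos (Real.exp (-δ)) (Real.exp_pos _) (Real.exp_lt_one_iff.2 (by linarith)).ne) fun n hn ↦
        (hB.quadVar_concentration hH hC h0 h1 hc htau hn (Real.exp_pos (-δ))).2
          (Real.exp_lt_one_iff.2 (by linarith)).le
    filter_upwards [hup, hlo] with ω hu hl
    filter_upwards [hu, hl, eventually_gt_atTop 0] with n hu hl hn
    simp only [not_le] at hu hl
    have hv := filteredVar_pos hH hC h0 hc hn
    have hS : 0 < quadVar c n (fun t ↦ B t ω) := (mul_pos (Real.exp_pos _) hv).trans hl
    have hu' := Real.log_lt_log hS hu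
    have hl' := Real.log_lt_log (mul_pos (Real.exp_pos _) hv) hl
    rw [Real.log_mul (Real.exp_pos _).ne' hv.ne', Real.log_exp] at hu' hl'
    exact abs_lt.2 ⟨by linarith, by linarith⟩
  filter_upwards [ae_all_iff.2 hδ] with ω hω
  rw [Metric.tendsto_atTop']
  intro ε hε
  obtain ⟨k, hk⟩ := exists_nat_one_div_lt hε
  obtain ⟨n₀, hn₀⟩ := eventually_atTop.1 (hω k)
  refine ⟨n₀, fun n hn ↦ ?_⟩
  rw [Real.dist_eq, sub_zero]
  exact (hn₀ n hn.le).trans hk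

end FBM

/-! ### The quantiles -/

lemma sub_one_sub_log_continuousOn : ContinuousOn (fun x : ℝ ↦ x - 1 - Real.log x) (Set.Ioi 0) :=
  (continuousOn_id.sub continuousOn_const).sub
    (Real.continuousOn_log.mono fun _ hx ↦ (ne_of_gt hx))

lemma sqrt_sub_one_sq_le {x : ℝ} (hx : 0 < x) : (√x - 1) ^ 2 ≤ x - 1 - Real.log x := by
  have h := Real.log_le_sub_one_of_pos (Real.sqrt_pos.2 hx)
  rw [Real.log_sqrt hx.le] at h
  nlinarith [Real.sq_sqrt hx.le]

lemma exists_one_lt_sub_log_eq {e : ℝ} (he : 0 < e) : ∃ x, 1 < x ∧ x - 1 - Real.log x = e := by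
  have hs : 0 < √e := Real.sqrt_pos.2 he
  have h1 : (1 : ℝ) ≤ (1 + √e) ^ 2 := by nlinarith
  have hcont : ContinuousOn (fun x : ℝ ↦ x - 1 - Real.log x) (Set.Icc 1 ((1 + √e) ^ 2)) :=
    sub_one_sub_log_continuousOn.mono fun x hx ↦ one_pos.trans_le hx.1
  have hmem : e ∈ Set.Ioc ((1 : ℝ) - 1 - Real.log 1)
      ((1 + √e) ^ 2 - 1 - Real.log ((1 + √e) ^ 2)) := by
    refine ⟨by simpa using he, ?_⟩
    have h := sqrt_sub_one_sq_le (x := (1 + √e) ^ 2) (by positivity)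
    rw [Real.sqrt_sq (by positivity), add_sub_cancel_left, Real.sq_sqrt he.le] at h
    exact h
  obtain ⟨x, hx, hxe⟩ := intermediate_value_Ioc h1 hcont hmem
  exact ⟨x, hx.1, hxe⟩

lemma exists_lt_one_sub_log_eq {e : ℝ} (he : 0 < e) :
    ∃ x, 0 < x ∧ x < 1 ∧ x - 1 - Real.log x = e := by
  have h0 := Real.exp_pos (-(e + 1))
  have h1 : Real.exp (-(e + 1)) ≤ 1 := (Real.exp_lt_one_iff.2 (by linarith)).le
  have hcont : ContinuousOn (fun x : ℝ ↦ x - 1 - Real.log x) (Set.Icc (Real.exp (-(e + 1))) 1) :=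
    sub_one_sub_log_continuousOn.mono fun x hx ↦ h0.trans_le hx.1
  have hmem : e ∈ Set.Ioc ((1 : ℝ) - 1 - Real.log 1)
      (Real.exp (-(e + 1)) - 1 - Real.log (Real.exp (-(e + 1)))) := by
    refine ⟨by simpa using he, ?_⟩
    rw [Real.log_exp]
    linarith
  obtain ⟨x, hx, hxe⟩ := intermediate_value_Ico' h1 hcont ⟨hmem.1, hmem.2⟩
  exact ⟨x, h0.trans_le hx.1, hx.2, hxe⟩

/-- Both tail bounds have the form `exp (-(n/κ) (x - 1 - log x))` in terms of `x = 1 ± t / √n`. -/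
lemma exp_mul_rpow_eq {x : ℝ} (hx : 0 < x) (n : ℕ) (κ : ℝ) :
    Real.exp (-(x - 1) * n / κ) * x ^ ((n : ℝ) / κ)
      = Real.exp (-((n : ℝ) / κ * (x - 1 - Real.log x))) := by
  rw [Real.rpow_def_of_pos hx, ← Real.exp_add]
  congr 1
  ring

lemma phiR_eq {n : ℕ} (hn : 0 < n) (κ : ℝ) {t : ℝ} (ht : 0 < t) :
    phiR n κ t = Real.exp (-((n : ℝ) / κ * (1 + t / √n - 1 - Real.log (1 + t / √n)))) := by
  have hs : 0 < √(n : ℝ) := Real.sqrt_pos.2 (by exact_mod_cast hn)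
  rw [← exp_mul_rpow_eq (by positivity), phiR]
  congr 2
  have : (n : ℝ) = √n * √n := (Real.mul_self_sqrt (Nat.cast_nonneg n)).symm
  rw [this, Real.sqrt_mul_self hs.le]
  field_simp
  ring

lemma phiL_eq {n : ℕ} (hn : 0 < n) (κ : ℝ) {t : ℝ} (ht : t ∈ Set.Ioo 0 (√(n : ℝ))) :
    phiL n κ t = Real.exp (-((n : ℝ) / κ * (1 - t / √n - 1 - Real.log (1 - t / √n)))) := by
  have hs : 0 < √(n : ℝ) := Real.sqrt_pos.2 (by exact_mod_cast hn)
  have hlt : t / √n < 1 := (div_lt_one hs).2 ht.2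
  rw [← exp_mul_rpow_eq (by linarith), phiL, Set.indicator_of_mem (Set.Ioo_subset_Icc_self ht)]
  congr 2
  have : (n : ℝ) = √n * √n := (Real.mul_self_sqrt (Nat.cast_nonneg n)).symm
  rw [this, Real.sqrt_mul_self hs.le]
  field_simp
  ring

lemma exp_neg_mul_eq_iff {n : ℕ} (hn : 0 < n) {κ β e : ℝ} (hκ : 0 < κ) (hβ : 0 < β) :
    Real.exp (-((n : ℝ) / κ * e)) = β ↔ e = κ * Real.log (1 / β) / n := by
  have hn0 : (0 : ℝ) < n := by exact_mod_cast hn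
  constructor
  · intro h
    rw [← h, one_div, Real.log_inv, Real.log_exp]
    field_simp
  · intro h
    have e' : -((n : ℝ) / κ * e) = Real.log β := by
      rw [h, one_div, Real.log_inv]
      field_simp
    rw [e', Real.exp_log hβ]

section Quantiles

variable {L : ℕ} {c : Fin (L + 1) → ℝ} {β : ℝ} {n : ℕ}

lemma xR_spec (hκ : 0 < kappa c) (hβ : β ∈ Set.Ioo (0 : ℝ) 1) (hn : 0 < n) :
    1 < xR c n β ∧ xR c n β - 1 - Real.log (xR c n β) = kappa c * Real.log (1 / β) / n := by
  have hn0 : (0 : ℝ) < n := by exact_mod_cast hn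
  have hs : 0 < √(n : ℝ) := Real.sqrt_pos.2 hn0
  have hlog : 0 < Real.log (1 / β) := Real.log_pos ((one_lt_div hβ.1).2 hβ.2)
  obtain ⟨x, hx1, hxe⟩ := exists_one_lt_sub_log_eq
    (e := kappa c * Real.log (1 / β) / n) (by positivity)
  have hex : ∃ t ∈ Set.Ioi (0 : ℝ), phiR n (kappa c) t = β := by
    have ht : 0 < (x - 1) * √(n : ℝ) := mul_pos (by linarith) hs
    refine ⟨(x - 1) * √n, ht, ?_⟩
    rw [phiR_eq hn _ ht, mul_div_cancel_right₀ _ hs.ne', add_sub_cancel,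
      exp_neg_mul_eq_iff hn hκ hβ.1, hxe]
  have hmem : 0 < quantR c n β := Function.invFunOn_mem hex
  have heq : phiR n (kappa c) (quantR c n β) = β := Function.invFunOn_eq hex
  rw [phiR_eq hn _ hmem, exp_neg_mul_eq_iff hn hκ hβ.1] at heq
  exact ⟨by rw [xR]; linarith [div_pos hmem hs], heq⟩

lemma xL_spec (hκ : 0 < kappa c) (hβ : β ∈ Set.Ioo (0 : ℝ) 1) (hn : 0 < n) :
    0 < xL c n β ∧ xL c n β < 1 ∧
      xL c n β - 1 - Real.log (xL c n β) = kappa c * Real.log (1 / β) / n := by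
  have hn0 : (0 : ℝ) < n := by exact_mod_cast hn
  have hs : 0 < √(n : ℝ) := Real.sqrt_pos.2 hn0
  have hlog : 0 < Real.log (1 / β) := Real.log_pos ((one_lt_div hβ.1).2 hβ.2)
  obtain ⟨x, hx0, hx1, hxe⟩ := exists_lt_one_sub_log_eq
    (e := kappa c * Real.log (1 / β) / n) (by positivity)
  have hex : ∃ t ∈ Set.Ioo 0 (√(n : ℝ)), phiL n (kappa c) t = β := by
    have ht : (1 - x) * √(n : ℝ) ∈ Set.Ioo 0 (√(n : ℝ)) :=
      ⟨mul_pos (by linarith) hs, by nlinarith⟩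
    refine ⟨(1 - x) * √n, ht, ?_⟩
    rw [phiL_eq hn _ ht, mul_div_cancel_right₀ _ hs.ne', sub_sub_cancel,
      exp_neg_mul_eq_iff hn hκ hβ.1, hxe]
  have hmem : quantL c n β ∈ Set.Ioo 0 (√(n : ℝ)) := Function.invFunOn_mem hex
  have heq : phiL n (kappa c) (quantL c n β) = β := Function.invFunOn_eq hex
  rw [phiL_eq hn _ hmem, exp_neg_mul_eq_iff hn hκ hβ.1] at heq
  have h1 := div_pos hmem.1 hs
  have h2 := (div_lt_one hs).2 hmem.2
  exact ⟨by rw [xL]; linarith, by rw [xL]; linarith, heq⟩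

end Quantiles

/-- Inversion of `x - 1 - log x ≈ (log x)² / 2` near `x = 1`. -/
lemma tendsto_sqrt_mul_abs_log {x : ℕ → ℝ} {D : ℝ} (hx : ∀ᶠ n in atTop, 0 < x n)
    (hx1 : ∀ᶠ n in atTop, x n ≠ 1)
    (hD : Tendsto (fun n : ℕ ↦ (n : ℝ) * (x n - 1 - Real.log (x n))) atTop (𝓝 D)) :
    Tendsto (fun n : ℕ ↦ √(n : ℝ) * |Real.log (x n)|) atTop (𝓝 (√(2 * D))) := by
  have hinv : Tendsto (fun n : ℕ ↦ ((n : ℝ))⁻¹) atTop (𝓝 0) :=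
    tendsto_inv_atTop_zero.comp tendsto_natCast_atTop_atTop
  have hh : Tendsto (fun n ↦ x n - 1 - Real.log (x n)) atTop (𝓝 0) := by
    have h := hinv.mul hD
    rw [zero_mul] at h
    refine h.congr' ?_
    filter_upwards [eventually_gt_atTop 0] with n hn
    have : (n : ℝ) ≠ 0 := by exact_mod_cast hn.ne'
    rw [inv_mul_cancel_left₀ this]
  have hsq : Tendsto (fun n ↦ (√(x n) - 1) ^ 2) atTop (𝓝 0) := by
    refine squeeze_zero' (.of_forall fun n ↦ sq_nonneg _) ?_ hh
    filter_upwards [hx] with n hn using sqrt_sub_one_sq_le hn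
  have hroot : Tendsto (fun n ↦ √(x n)) atTop (𝓝 1) := by
    have h := hsq.sqrt
    simp only [Real.sqrt_sq_eq_abs, Real.sqrt_zero] at h
    simpa using ((tendsto_zero_iff_abs_tendsto_zero _).2 h).add_const 1
  have hxlim : Tendsto x atTop (𝓝 1) := by
    have h := hroot.pow 2
    rw [one_pow] at h
    refine h.congr' ?_
    filter_upwards [hx] with n hn using Real.sq_sqrt hn.le
  have hy : Tendsto (fun n ↦ Real.log (x n)) atTop (𝓝 0) := by
    have h := hxlim.log one_ne_zero
    rwa [Real.log_one] at h
  have hy0 : ∀ᶠ n in atTop, Real.log (x n) ≠ 0 := by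
    filter_upwards [hx, hx1] with n h h1
    exact (Real.log_ne_zero_of_pos_of_ne_one h h1)
  have hbound : ∀ᶠ n in atTop, |(x n - 1 - Real.log (x n)) / Real.log (x n) ^ 2 - 1 / 2|
      ≤ |Real.log (x n)| := by
    have hsmall : ∀ᶠ n in atTop, |Real.log (x n)| ≤ 1 := by
      have h := hy.abs
      rw [abs_zero] at h
      exact h.eventually_le_const one_pos
    filter_upwards [hx, hy0, hsmall] with n hn h0 h1
    have hexp := Real.exp_bound h1 (n := 3) (by norm_num)
    rw [Real.exp_log hn] at hexp
    set y := Real.log (x n)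
    have hsum : ∑ m ∈ Finset.range 3, y ^ m / (m.factorial : ℝ) = 1 + y + y ^ 2 / 2 := by
      simp [Finset.sum_range_succ, Nat.factorial]
    rw [hsum] at hexp
    have hy2 : 0 < y ^ 2 := by positivity
    have e : (x n - 1 - y) / y ^ 2 - 1 / 2 = (x n - (1 + y + y ^ 2 / 2)) / y ^ 2 := by
      field_simp
      ring
    rw [e, abs_div, abs_of_pos hy2, div_le_iff₀ hy2]
    refine hexp.trans ?_
    have h3 : |y| ^ 3 = |y| * y ^ 2 := by rw [← sq_abs]; ring
    rw [h3]
    refine mul_le_of_le_one_right (by positivity) ?_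
    norm_num [Nat.factorial]
  have hratio : Tendsto (fun n ↦ (x n - 1 - Real.log (x n)) / Real.log (x n) ^ 2) atTop
      (𝓝 (1 / 2)) := by
    rw [tendsto_iff_norm_sub_tendsto_zero]
    have h := hy.abs
    rw [abs_zero] at h
    exact squeeze_zero' (.of_forall fun n ↦ norm_nonneg _) hbound h
  have hfin : Tendsto (fun n : ℕ ↦ (n : ℝ) * Real.log (x n) ^ 2) atTop (𝓝 (2 * D)) := by
    have h := hD.div hratio (by norm_num)
    rw [show D / (1 / 2) = 2 * D by ring] at h
    refine h.congr' ?_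
    filter_upwards [hx, hx1, hy0] with n hn h1 h0
    have : 0 < x n - 1 - Real.log (x n) := by linarith [Real.log_lt_sub_one_of_pos hn h1]
    simp only [Pi.div_apply]
    field_simp
  refine hfin.sqrt.congr fun n ↦ ?_
  rw [Real.sqrt_mul (Nat.cast_nonneg n), Real.sqrt_sq_eq_abs]

section QuantileLimits

variable {L : ℕ} {c : Fin (L + 1) → ℝ} {β : ℝ}

lemma tendsto_nat_mul_div_sub (κ : ℝ) (k : ℕ) :
    Tendsto (fun n : ℕ ↦ (n : ℝ) * (κ / ((n - k : ℕ) : ℝ))) atTop (𝓝 κ) := by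
  rw [← tendsto_add_atTop_iff_nat k]
  simp only [Nat.add_sub_cancel]
  have hinv : Tendsto (fun n : ℕ ↦ ((n : ℝ))⁻¹) atTop (𝓝 0) :=
    tendsto_inv_atTop_zero.comp tendsto_natCast_atTop_atTop
  have h := ((hinv.const_mul (k : ℝ)).const_add 1).mul_const κ
  rw [mul_zero, add_zero, one_mul] at h
  refine h.congr' ?_
  filter_upwards [eventually_gt_atTop 0] with n hn
  have : (n : ℝ) ≠ 0 := by exact_mod_cast hn.ne'
  push_cast
  field_simp

lemma tendsto_sqrt_mul_log_xR (hκ : 0 < kappa c) (hβ : β ∈ Set.Ioo (0 : ℝ) 1) (k : ℕ) :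
    Tendsto (fun n : ℕ ↦ √(n : ℝ) * Real.log (xR c (n - k) β)) atTop (𝓝 (quantLim c β)) := by
  have hspec : ∀ᶠ n : ℕ in atTop, 1 < xR c (n - k) β ∧ xR c (n - k) β - 1
      - Real.log (xR c (n - k) β) = kappa c * Real.log (1 / β) / ((n - k : ℕ) : ℝ) := by
    filter_upwards [eventually_gt_atTop k] with n hn using xR_spec hκ hβ (Nat.sub_pos_of_lt hn)
  have h := tendsto_sqrt_mul_abs_log (hspec.mono fun n hn ↦ one_pos.trans hn.1)
    (hspec.mono fun n hn ↦ hn.1.ne') ((tendsto_nat_mul_div_sub (kappa c * Real.log (1 / β)) k).congr'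
      (hspec.mono fun n hn ↦ by simp only [hn.2]))
  rw [← mul_assoc] at h
  refine h.congr' (hspec.mono fun n hn ↦ ?_)
  rw [abs_of_pos (Real.log_pos hn.1)]

lemma tendsto_sqrt_mul_log_xL (hκ : 0 < kappa c) (hβ : β ∈ Set.Ioo (0 : ℝ) 1) (k : ℕ) :
    Tendsto (fun n : ℕ ↦ √(n : ℝ) * Real.log (xL c (n - k) β)) atTop (𝓝 (-quantLim c β)) := by
  have hspec : ∀ᶠ n : ℕ in atTop, 0 < xL c (n - k) β ∧ xL c (n - k) β < 1 ∧ xL c (n - k) β - 1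
      - Real.log (xL c (n - k) β) = kappa c * Real.log (1 / β) / ((n - k : ℕ) : ℝ) := by
    filter_upwards [eventually_gt_atTop k] with n hn using xL_spec hκ hβ (Nat.sub_pos_of_lt hn)
  have h := tendsto_sqrt_mul_abs_log (hspec.mono fun n hn ↦ hn.1)
    (hspec.mono fun n hn ↦ hn.2.1.ne) ((tendsto_nat_mul_div_sub (kappa c * Real.log (1 / β)) k).congr'
      (hspec.mono fun n hn ↦ by simp only [hn.2.2]))
  rw [← mul_assoc] at h
  refine h.neg.congr' (hspec.mono fun n hn ↦ ?_)
  rw [abs_of_neg (Real.log_neg hn.1 hn.2.1)]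
  ring

lemma quantLim_pos (hκ : 0 < kappa c) (hβ : β ∈ Set.Ioo (0 : ℝ) 1) : 0 < quantLim c β := by
  have hlog : 0 < Real.log (1 / β) := Real.log_pos ((one_lt_div hβ.1).2 hβ.2)
  exact Real.sqrt_pos.2 (by positivity)

end QuantileLimits

/-! ### Linear combinations over the dilations -/

section Combination

variable {ℓ : ℕ} {a : Fin (ℓ + 1) → ℝ} {M : ℕ} {d : ℕ → ℝ} {α : ℝ}

lemma dotM_sub (u w : ℕ → ℝ) : dotM M d (fun m ↦ u m - w m) = dotM M d u - dotM M d w := by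
  simp only [dotM, mul_sub, Finset.sum_sub_distrib]

/-- The log-variances depend on `m` only through `2 H log m`, up to a constant that `d` kills. -/
lemma dotM_log_filteredVar {H C : ℝ} (hH : H ∈ Set.Ioo (0 : ℝ) 1) (hC : 0 < C)
    (h0 : ∑ q, a q = 0) (hc : a ≠ 0) (hdsum : ∑ m ∈ Finset.Icc 1 M, d m = 0) {n : ℕ} (hn : 0 < n) :
    dotM M d (fun m ↦ Real.log (filteredVar (dilate m a) H C n)) = 2 * H * dotM M d logVec := by
  have hv := filteredVar_pos hH hC h0 hc hn
  have e : ∀ m ∈ Finset.Icc 1 M, d m * Real.log (filteredVar (dilate m a) H C n)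
      = d m * Real.log (filteredVar a H C n) + 2 * H * (d m * logVec m) := by
    intro m hm
    have hm1 := (Finset.mem_Icc.1 hm).1
    have hm0 : (0 : ℝ) < m := by exact_mod_cast hm1
    have : filteredVar (dilate m a) H C n = (m : ℝ) ^ (2 * H) * filteredVar a H C n := by
      rw [filteredVar, covFun_dilate_zero hm1, filteredVar]
      ring
    rw [this, Real.log_mul (Real.rpow_pos_of_pos hm0 _).ne' hv.ne', Real.log_rpow hm0, logVec]
    ring
  rw [dotM, Finset.sum_congr rfl e, Finset.sum_add_distrib, ← Finset.sum_mul, hdsum, zero_mul,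
    zero_add, ← Finset.mul_sum, dotM]

lemma div_two_mul_nat_mem_Ioo (hM : 1 ≤ M) (hα : α ∈ Set.Ioo (0 : ℝ) 1) :
    α / (2 * M) ∈ Set.Ioo (0 : ℝ) 1 := by
  have hM0 : (1 : ℝ) ≤ M := by exact_mod_cast hM
  have := hα.1
  refine ⟨by positivity, (div_lt_one (by positivity)).2 ?_⟩
  linarith [hα.2]

lemma ciLength_eq (n : ℕ) :
    ciLength a M d α n = (dotM M d (logXinf a M d α n) - dotM M d (logXsup a M d α n))
      / (2 * dotM M d logVec) := by
  rw [ciLength, dotM_sub]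

/-- If every log-ratio `u m` lies between its quantiles, then `dᵀu` lies between the corresponding
combinations: the definitions choose the quantile according to the sign of `d m`. -/
lemma dotM_mem_Icc_of_mem_Icc {u : ℕ → ℝ} {n : ℕ}
    (hu : ∀ m ∈ Finset.Icc 1 M,
      Real.log (xL (dilate m a) (n - m * ℓ) (α / (2 * M))) ≤ u m ∧
      u m ≤ Real.log (xR (dilate m a) (n - m * ℓ) (α / (2 * M)))) :
    dotM M d u ∈ Set.Icc (dotM M d (logXsup a M d α n)) (dotM M d (logXinf a M d α n)) := by
  refine ⟨Finset.sum_le_sum fun m hm ↦ ?_, Finset.sum_le_sum fun m hm ↦ ?_⟩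
  · rw [logXsup]
    split_ifs with h
    · exact mul_le_mul_of_nonpos_left (hu m hm).2 h.le
    · exact mul_le_mul_of_nonneg_left (hu m hm).1 (not_lt.1 h)
  · rw [logXinf]
    split_ifs with h
    · exact mul_le_mul_of_nonpos_left (hu m hm).1 h.le
    · exact mul_le_mul_of_nonneg_left (hu m hm).2 (not_lt.1 h)

lemma tendsto_sqrt_mul_dotM_logXinf
    (hκ : ∀ m ∈ Finset.Icc 1 M, 0 < kappa (dilate m a))
    (hα : α ∈ Set.Ioo (0 : ℝ) 1) :
    Tendsto (fun n : ℕ ↦ √(n : ℝ) * dotM M d (logXinf a M d α n))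
    atTop (𝓝 (dotM M d (quantVec a M d α))) := by
  simp only [dotM, Finset.mul_sum]
  refine tendsto_finsetSum _ fun m hm ↦ ?_
  have hβ := div_two_mul_nat_mem_Ioo (M := M)
    ((Finset.mem_Icc.1 hm).1.trans (Finset.mem_Icc.1 hm).2) hα
  simp_rw [mul_left_comm (√_) (d m)]
  refine Tendsto.const_mul _ ?_
  simp only [logXinf, quantVec]
  split_ifs
  · exact tendsto_sqrt_mul_log_xL (hκ m hm) hβ (m * ℓ)
  · exact tendsto_sqrt_mul_log_xR (hκ m hm) hβ (m * ℓ)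

lemma tendsto_sqrt_mul_dotM_logXsup
    (hκ : ∀ m ∈ Finset.Icc 1 M, 0 < kappa (dilate m a))
    (hα : α ∈ Set.Ioo (0 : ℝ) 1) :
    Tendsto (fun n : ℕ ↦ √(n : ℝ) * dotM M d (logXsup a M d α n))
    atTop (𝓝 (-dotM M d (quantVec a M d α))) := by
  simp only [dotM, Finset.mul_sum, ← Finset.sum_neg_distrib]
  refine tendsto_finsetSum _ fun m hm ↦ ?_
  have hβ := div_two_mul_nat_mem_Ioo (M := M)
    ((Finset.mem_Icc.1 hm).1.trans (Finset.mem_Icc.1 hm).2) hα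
  simp_rw [mul_left_comm (√_) (d m), ← mul_neg]
  refine Tendsto.const_mul _ ?_
  simp only [logXsup, quantVec]
  split_ifs
  · rw [neg_neg]
    exact tendsto_sqrt_mul_log_xR (hκ m hm) hβ (m * ℓ)
  · exact tendsto_sqrt_mul_log_xL (hκ m hm) hβ (m * ℓ)

lemma tendsto_zero_of_sqrt_mul {f : ℕ → ℝ} {b : ℝ}
    (h : Tendsto (fun n : ℕ ↦ √(n : ℝ) * f n) atTop (𝓝 b)) : Tendsto f atTop (𝓝 0) := by
  have hinv : Tendsto (fun n : ℕ ↦ (√(n : ℝ))⁻¹) atTop (𝓝 0) :=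
    tendsto_inv_atTop_zero.comp (Real.tendsto_sqrt_atTop.comp tendsto_natCast_atTop_atTop)
  have h2 := hinv.mul h
  rw [zero_mul] at h2
  refine h2.congr' ?_
  filter_upwards [eventually_gt_atTop 0] with n hn
  have : √(n : ℝ) ≠ 0 := (Real.sqrt_pos.2 (by exact_mod_cast hn)).ne'
  rw [inv_mul_cancel_left₀ this]

lemma ciLength_isEquivalent
    (hκ : ∀ m ∈ Finset.Icc 1 M, 0 < kappa (dilate m a))
    (hα : α ∈ Set.Ioo (0 : ℝ) 1) (hM : 1 ≤ M) (hd : ∀ m ∈ Finset.Icc 1 M, d m ≠ 0)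
    (hdL : 0 < dotM M d logVec) :
    (fun n : ℕ ↦ ciLength a M d α n) ~[atTop]
      (fun n : ℕ ↦ 1 / √(n : ℝ) * (dotM M d (quantVec a M d α) / dotM M d logVec)) := by
  have hq : 0 < dotM M d (quantVec a M d α) := by
    refine Finset.sum_pos (fun m hm ↦ ?_) ⟨1, Finset.mem_Icc.2 ⟨le_rfl, hM⟩⟩
    have hpos := quantLim_pos (hκ m hm) (div_two_mul_nat_mem_Ioo hM hα)
    rw [quantVec]
    split_ifs with h
    · exact mul_pos_of_neg_of_neg h (neg_neg_of_pos hpos)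
    · exact mul_pos (lt_of_le_of_ne (not_lt.1 h) (hd m hm).symm) hpos
  have hlim : Tendsto (fun n : ℕ ↦ √(n : ℝ) * ciLength a M d α n) atTop
      (𝓝 (dotM M d (quantVec a M d α) / dotM M d logVec)) := by
    have h := ((tendsto_sqrt_mul_dotM_logXinf (d := d) hκ hα).sub
      (tendsto_sqrt_mul_dotM_logXsup (d := d) hκ hα)).div_const (2 * dotM M d logVec)
    rw [show (dotM M d (quantVec a M d α) - -dotM M d (quantVec a M d α)) / (2 * dotM M d logVec)
      = dotM M d (quantVec a M d α) / dotM M d logVec by field_simp; ring] at h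
    refine h.congr fun n ↦ ?_
    rw [ciLength_eq]
    ring
  have hne : dotM M d (quantVec a M d α) / dotM M d logVec ≠ 0 := (div_pos hq hdL).ne'
  have hequiv := (IsEquivalent.refl (u := fun n : ℕ ↦ 1 / √(n : ℝ)) (l := atTop)).mul
    ((isEquivalent_const_iff_tendsto hne).2 hlim)
  refine hequiv.congr_left ?_
  filter_upwards [eventually_gt_atTop 0] with n hn
  have : √(n : ℝ) ≠ 0 := (Real.sqrt_pos.2 (by exact_mod_cast hn)).ne'
  simp only [Pi.mul_apply]
  field_simp

lemma ciLength_nonneg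
    (hκ : ∀ m ∈ Finset.Icc 1 M, 0 < kappa (dilate m a))
    (hα : α ∈ Set.Ioo (0 : ℝ) 1)
    (hdL : 0 < dotM M d logVec) {n : ℕ} (hn : M * ℓ < n) :
    0 ≤ ciLength a M d α n := by
  rw [ciLength]
  refine div_nonneg (Finset.sum_nonneg fun m hm ↦ ?_) (by positivity)
  have hm' := Finset.mem_Icc.1 hm
  have hβ := div_two_mul_nat_mem_Ioo (M := M) (hm'.1.trans hm'.2) hα
  have hN : 0 < n - m * ℓ :=
    Nat.sub_pos_of_lt ((Nat.mul_le_mul_right ℓ hm'.2).trans_lt hn)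
  have hR := Real.log_pos (xR_spec (hκ m hm) hβ hN).1
  have hL := Real.log_neg (xL_spec (hκ m hm) hβ hN).1 (xL_spec (hκ m hm) hβ hN).2.1
  simp only [logXinf, logXsup]
  split_ifs with h
  · exact mul_nonneg_of_nonpos_of_nonpos h.le (by linarith)
  · exact mul_nonneg (not_lt.1 h) (by linarith)

end Combination

/-! ### Coverage and convergence -/

section Main

variable {Ω : Type*} [MeasurableSpace Ω] {P : Measure Ω} {H C : ℝ} {B : ℝ → Ω → ℝ}
  {L : ℕ} {c : Fin (L + 1) → ℝ}

/-- With the quantiles of level `β`, the exponential bound on each tail equals `β`. -/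
lemma IsFractionalBrownianMotion.measureReal_log_quadVar_notMem_le (hH : H ∈ Set.Ioo (0 : ℝ) 1)
    (hC : 0 < C) (hB : IsFractionalBrownianMotion P H C B) (h0 : ∑ q, c q = 0)
    (h1 : ∑ q : Fin (L + 1), ((q : ℕ) : ℝ) * c q = 0) (hc : c ≠ 0) (htau : tau c ≠ 0)
    {n : ℕ} (hn : L < n) {β : ℝ} (hβ : β ∈ Set.Ioo (0 : ℝ) 1) :
    P.real {ω | ¬ (Real.log (xL c (n - L) β)
        ≤ Real.log (quadVar c n (fun t ↦ B t ω)) - Real.log (filteredVar c H C n) ∧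
      Real.log (quadVar c n (fun t ↦ B t ω)) - Real.log (filteredVar c H C n)
        ≤ Real.log (xR c (n - L) β))} ≤ 2 * β := by
  have hprob := hB.gaussian.isProbabilityMeasure
  obtain ⟨hκ, -⟩ := kappa_pos_and_sum_le h0 h1 hc htau
  have hN : 0 < n - L := Nat.sub_pos_of_lt hn
  obtain ⟨hR1, hRe⟩ := xR_spec hκ hβ hN
  obtain ⟨hL0, hL1, hLe⟩ := xL_spec hκ hβ hN
  have hv := filteredVar_pos hH hC h0 hc (L.zero_le.trans_lt hn)
  have hr := (hB.quadVar_concentration hH hC h0 h1 hc htau hn (one_pos.trans hR1)).1 hR1.le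
  have hl := (hB.quadVar_concentration hH hC h0 h1 hc htau hn hL0).2 hL1.le
  rw [← Nat.cast_sub hn.le, (exp_neg_mul_eq_iff hN hκ hβ.1).2 hRe] at hr
  rw [← Nat.cast_sub hn.le, (exp_neg_mul_eq_iff hN hκ hβ.1).2 hLe] at hl
  calc _ ≤ P.real ({ω | xR c (n - L) β * filteredVar c H C n ≤ quadVar c n (fun t ↦ B t ω)} ∪
        {ω | quadVar c n (fun t ↦ B t ω) ≤ xL c (n - L) β * filteredVar c H C n}) := by
        refine measureReal_mono fun ω hω ↦ ?_
        by_contra hcon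
        apply hω
        simp only [Set.mem_union, Set.mem_ofPred_eq, not_or, not_le] at hcon
        have hS : 0 < quadVar c n (fun t ↦ B t ω) := (mul_pos hL0 hv).trans hcon.2
        have hu := Real.log_lt_log hS hcon.1
        have hd := Real.log_lt_log (mul_pos hL0 hv) hcon.2
        rw [Real.log_mul (one_pos.trans hR1).ne' hv.ne'] at hu
        rw [Real.log_mul hL0.ne' hv.ne'] at hd
        constructor <;> linarith
    _ ≤ _ := measureReal_union_le _ _
    _ ≤ 2 * β := by linarith

end Main

end HurstCI

end

theorem proposition5 {Ω : Type*} [MeasurableSpace Ω] (P : Measure Ω) [IsProbabilityMeasure P]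
    (H C : ℝ) (hH : H ∈ Set.Ioo (0 : ℝ) 1) (hC : 0 < C)
    (B : ℝ → Ω → ℝ) (hB : HurstCI.IsFractionalBrownianMotion P H C B)
    (ℓ p : ℕ) (a : Fin (ℓ + 1) → ℝ) (hp : 2 ≤ p) (ha : HurstCI.IsFilterOfOrder a p)
    (htau : HurstCI.tau a ≠ 0)
    (M : ℕ) (hM : 2 ≤ M) (d : ℕ → ℝ) (hd : ∀ m ∈ Finset.Icc 1 M, d m ≠ 0)
    (hdsum : ∑ m ∈ Finset.Icc 1 M, d m = 0) (hdL : 0 < HurstCI.dotM M d HurstCI.logVec)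
    (α : ℝ) (hα : α ∈ Set.Ioo (0 : ℝ) 1) :
    (∀ n : ℕ, M * ℓ + 1 ≤ n →
      1 - α ≤ P.real {ω | H ∈ Set.Icc (HurstCI.Hinf a M d α n (fun t => B t ω))
        (HurstCI.Hsup a M d α n (fun t => B t ω))}) ∧
    (∀ᵐ ω ∂P,
      Tendsto (fun n : ℕ => HurstCI.Hinf a M d α n (fun t => B t ω)) atTop (𝓝 H) ∧
      Tendsto (fun n : ℕ => HurstCI.Hsup a M d α n (fun t => B t ω)) atTop (𝓝 H) ∧
      ∀ᶠ n : ℕ in atTop,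
        HurstCI.Hinf a M d α n (fun t => B t ω) ≤ HurstCI.Hsup a M d α n (fun t => B t ω) ∧
        HurstCI.Hsup a M d α n (fun t => B t ω) - HurstCI.Hinf a M d α n (fun t => B t ω)
          = HurstCI.ciLength a M d α n) ∧
    (fun n : ℕ => HurstCI.ciLength a M d α n) ~[atTop]
      (fun n : ℕ => 1 / √(n : ℝ) *
        (HurstCI.dotM M d (HurstCI.quantVec a M d α) / HurstCI.dotM M d HurstCI.logVec)) := by
  open HurstCI in
  have h0 : ∑ q, a q = 0 := by simpa using ha.1 0 (by omega)
  have h1 : ∑ q : Fin (ℓ + 1), ((q : ℕ) : ℝ) * a q = 0 := by simpa using ha.1 1 (by omega)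
  have hane : a ≠ 0 := by
    rintro rfl
    exact ha.2 (by simp)
  have hM1 : 1 ≤ M := by omega
  have hM0 : (0 : ℝ) < M := by exact_mod_cast hM1
  -- The dilated filters inherit the hypotheses on `a`.
  have hdil : ∀ m ∈ Finset.Icc 1 M, ∑ i, dilate m a i = 0 ∧
      ∑ i : Fin (m * ℓ + 1), ((i : ℕ) : ℝ) * dilate m a i = 0 ∧
      dilate m a ≠ 0 ∧ tau (dilate m a) ≠ 0 := by
    intro m hm
    have hm1 := (Finset.mem_Icc.1 hm).1
    have hm0 : (m : ℝ) ≠ 0 := by exact_mod_cast (by omega : m ≠ 0)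
    exact ⟨sum_dilate_eq_zero hm1 h0, sum_mul_dilate_eq_zero hm1 h1, dilate_ne_zero hm1 hane,
      by rw [tau_dilate hm1 h0 h1]; exact mul_ne_zero (pow_ne_zero 2 hm0) htau⟩
  have hκ : ∀ m ∈ Finset.Icc 1 M, 0 < kappa (dilate m a) := fun m hm ↦
    have h := hdil m hm
    (kappa_pos_and_sum_le h.1 h.2.1 h.2.2.1 h.2.2.2).1
  have hβ := div_two_mul_nat_mem_Ioo hM1 hα
  let u : ℕ → Ω → ℕ → ℝ := fun n ω m ↦
    logS a n (fun t ↦ B t ω) m - Real.log (filteredVar (dilate m a) H C n)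
  have hlogS : ∀ n, 0 < n → ∀ ω, dotM M d (logS a n (fun t ↦ B t ω))
      = dotM M d (u n ω) + 2 * H * dotM M d logVec := by
    intro n hn ω
    rw [← dotM_log_filteredVar hH hC h0 hane hdsum hn, dotM_sub]
    ring
  have hrw : ∀ n, 0 < n → ∀ ω X, 1 / (2 * dotM M d logVec)
      * (dotM M d (logS a n (fun t ↦ B t ω)) - dotM M d X)
      = H + (dotM M d (u n ω) - dotM M d X) / (2 * dotM M d logVec) := by
    intro n hn ω X
    rw [hlogS n hn]
    field_simp
    ring
  refine ⟨fun n hn ↦ ?_, ?_, ciLength_isEquivalent hκ hα hM1 hd hdL⟩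
  · have hn0 : 0 < n := by omega
    let E : ℕ → Set Ω := fun m ↦ {ω | ¬ (
      Real.log (xL (dilate m a) (n - m * ℓ) (α / (2 * M))) ≤ u n ω m ∧
      u n ω m ≤ Real.log (xR (dilate m a) (n - m * ℓ) (α / (2 * M))))}
    have hE : ∀ m ∈ Finset.Icc 1 M, P.real (E m) ≤ 2 * (α / (2 * M)) := fun m hm ↦
      have h := hdil m hm
      hB.measureReal_log_quadVar_notMem_le hH hC h.1 h.2.1 h.2.2.1 h.2.2.2
        ((Nat.mul_le_mul_right ℓ (Finset.mem_Icc.1 hm).2).trans_lt hn) hβ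
    have hU : P.real (⋃ m ∈ Finset.Icc 1 M, E m) ≤ α := by
      refine (measureReal_biUnion_finset_le _ _).trans ((Finset.sum_le_sum hE).trans_eq ?_)
      rw [Finset.sum_const, Nat.card_Icc, nsmul_eq_mul, Nat.add_sub_cancel]
      field_simp
    have hcover : (Set.univ : Set Ω) ⊆ {ω | H ∈ Set.Icc (Hinf a M d α n (fun t => B t ω))
        (Hsup a M d α n (fun t => B t ω))} ∪ ⋃ m ∈ Finset.Icc 1 M, E m := by
      intro ω _
      by_cases hω : ω ∈ ⋃ m ∈ Finset.Icc 1 M, E m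
      · exact .inr hω
      · left
        simp only [Set.mem_iUnion, not_exists] at hω
        obtain ⟨hlo, hup⟩ := dotM_mem_Icc_of_mem_Icc (a := a) (d := d) (α := α) (u := u n ω)
          (n := n) fun m hm ↦ not_not.1 (hω m hm)
        refine ⟨?_, ?_⟩
        · rw [Hinf, hrw n hn0]
          refine max_le hH.1.le ?_
          have : (dotM M d (u n ω) - dotM M d (logXinf a M d α n)) / (2 * dotM M d logVec) ≤ 0 :=
            div_nonpos_of_nonpos_of_nonneg (by linarith) (by positivity)
          linarith
        · rw [Hsup, hrw n hn0]
          refine le_min hH.2.le ?_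
          have : 0 ≤ (dotM M d (u n ω) - dotM M d (logXsup a M d α n)) / (2 * dotM M d logVec) :=
            div_nonneg (by linarith) (by positivity)
          linarith
    have h := (measureReal_mono (μ := P) hcover).trans (measureReal_union_le _ _)
    rw [probReal_univ] at h
    linarith
  · have hae : ∀ᵐ ω ∂P, ∀ m ∈ Finset.Icc 1 M, Tendsto (fun n ↦ u n ω m) atTop (𝓝 0) := by
      refine (Finset.eventually_all _).2 fun m hm ↦ ?_
      have h := hdil m hm
      exact hB.ae_tendsto_log_quadVar hH hC h.1 h.2.1 h.2.2.1 h.2.2.2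
    filter_upwards [hae] with ω hω
    have hu : Tendsto (fun n ↦ dotM M d (u n ω)) atTop (𝓝 0) := by
      have h := tendsto_finsetSum (Finset.Icc 1 M) fun m hm ↦ (hω m hm).const_mul (d m)
      simpa [dotM] using h
    have hlim : ∀ X : ℕ → ℕ → ℝ, Tendsto (fun n ↦ dotM M d (X n)) atTop (𝓝 0) →
        Tendsto (fun n ↦ 1 / (2 * dotM M d logVec)
          * (dotM M d (logS a n (fun t ↦ B t ω)) - dotM M d (X n))) atTop (𝓝 H) := by
      intro X hX
      have h := ((hu.sub hX).div_const (2 * dotM M d logVec)).const_add H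
      rw [sub_zero, zero_div, add_zero] at h
      refine h.congr' ?_
      filter_upwards [eventually_gt_atTop 0] with n hn
      rw [hrw n hn]
    have hi := hlim _ (tendsto_zero_of_sqrt_mul (tendsto_sqrt_mul_dotM_logXinf (d := d) hκ hα))
    have hs := hlim _ (tendsto_zero_of_sqrt_mul (tendsto_sqrt_mul_dotM_logXsup (d := d) hκ hα))
    refine ⟨?_, ?_, ?_⟩
    · have h := (tendsto_const_nhds (x := (0 : ℝ))).max hi
      rwa [max_eq_right hH.1.le] at h
    · have h := (tendsto_const_nhds (x := (1 : ℝ))).min hs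
      rwa [min_eq_right hH.2.le] at h
    · filter_upwards [hi.eventually_const_lt hH.1, hs.eventually_lt_const hH.2,
        eventually_gt_atTop (M * ℓ)] with n hni hns hn
      have hlen : Hsup a M d α n (fun t ↦ B t ω) - Hinf a M d α n (fun t ↦ B t ω)
          = ciLength a M d α n := by
        rw [Hsup, Hinf, min_eq_right hns.le, max_eq_right hni.le, ciLength_eq]
        ring
      have hnn := ciLength_nonneg hκ hα hdL hn
      exact ⟨by linarith, hlen⟩
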